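/- For a nonnegative integer $k$ put $(x;q)_k=\prod_{i=0}^{k-1}(1-xq^i)$, for a nonnegative integer $r$ let $[r]=(1-q^r)/(1-q)$, and let $\Phi_n(q)$ be the $n$-th cyclotomic polynomial, where $q$ is an indeterminate. For rational functions $A,B\in\mathbb{Q}(q)$ and a nonzero polynomial $P\in\mathbb{Q}[q]$, write $A\equiv B\pmod P$ if $P$ divides the numerator of $A-B$ written in lowest terms. Theorem. Let $n$ be a positive integer with $n\equiv 2\pmod 3$, and let $M=(2n-1)/3$ or $M=n-1$. Then $$\sum_{k=0}^{M}[6k+1]\frac{(q;q^3)_k^6}{(q^3;q^3)_k^6}\,q^{3k}\equiv 5\,[2n]\,\frac{(q^2;q^3)_{(2n-1)/3}^3}{(q^3;q^3)_{(2n-1)/3}^3}\pmod{[n]\,\Phi_n(q)^5}.$$ -/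

import Mathlib

/-- The `q`-shifted factorial `(x; q)_n = (1 - x)(1 - x q) ⋯ (1 - x q ^ (n - 1))`. -/
def qShifted {K : Type*} [Field K] (x q : K) (n : ℕ) : K :=
  ∏ i ∈ Finset.range n, (1 - x * q ^ i)

/-- The `q`-integer `[r] = (1 - q ^ r) / (1 - q)`. -/
def qInteger {K : Type*} [Field K] (q : K) (r : ℕ) : K :=
  (1 - q ^ r) / (1 - q)

/-- The `q`-integer `[n]` in the indeterminate `q`, as the polynomial
`1 + q + ⋯ + q ^ (n - 1)`. -/
noncomputable def qIntegerPoly (n : ℕ) : Polynomial ℚ :=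
  ∑ i ∈ Finset.range n, (Polynomial.X : Polynomial ℚ) ^ i

/-- The polynomial `qIntegerPoly n` is the rational function `(1 - q ^ n) / (1 - q)`. -/
theorem qIntegerPoly_eq_qInteger (n : ℕ) :
    algebraMap (Polynomial ℚ) (RatFunc ℚ) (qIntegerPoly n) =
      qInteger (RatFunc.X : RatFunc ℚ) n := by
  have hX : (RatFunc.X : RatFunc ℚ) ≠ 1 := by
    intro h
    rw [← RatFunc.algebraMap_X, ← map_one (algebraMap (Polynomial ℚ) (RatFunc ℚ))] at h
    exact Polynomial.X_ne_C (1 : ℚ) (by simpa using RatFunc.algebraMap_injective ℚ h)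
  have hX' : (1 : RatFunc ℚ) - RatFunc.X ≠ 0 := sub_ne_zero.mpr hX.symm
  rw [qIntegerPoly, qInteger, map_sum, eq_div_iff hX']
  simp only [map_pow, RatFunc.algebraMap_X]
  exact geom_sum_mul_neg _ _

/-- Congruence of rational functions in `q` modulo a polynomial `P`: written in lowest terms,
`A - B` has a numerator divisible by `P` (so its denominator is coprime to `P`). -/
def QCongr (P : Polynomial ℚ) (A B : RatFunc ℚ) : Prop :=
  P ∣ (A - B).num

/-! Write n = 3t + 2 and m = 2t + 1, so that 3m + 1 = 2n. Since [n] is the product of Φ_d over the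
divisors d > 1 of n, and distinct cyclotomic polynomials are coprime, it suffices to show that the
difference of the two sides is divisible by Φ_n^6 and by each such Φ_d, locally at these primes.

For Φ_n^6, replace the six parameters q by q x_j with x_j = exp(ε_j T), where the ε_j are 0, w, w^2,
w^3, w^4, 1 and w is a primitive fifth root of unity, and put q = ζ exp(s) with ζ a primitive n-th
root of unity. Multiplying T by w permutes the x_j, so only powers of T^5 occur. At s = 0 the sum is
antisymmetric under k ↦ m - k and vanishes for every T (`clearedSum_eq_zero`). Hence every term
involving T is divisible by s T^5, and substituting T = c s changes the sum only by a multiple of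
s^6 (`ExpSum.X_pow_dvd_eval_sub`). For c = -2n the parameter q x_5 becomes q^(-3m), while ∑ ε_j = 0
makes the series balanced, so Jackson's sum evaluates it (`jackson_sum`, `clearedSum_mul_eq`). The
evaluation has the factor 1 - q^(2n) and three products, each with one factor vanishing at s = 0.
These account for s^4, so comparing the cofactors through first order in s gives s^6
(`X_pow_dvd_shiftedExp_sub`). The factor 5 is (1 + 2(w + w^2))(1 + 2(w + w^3))(1 + 2(w^2 + w^3)). As
Φ_n has a simple zero at ζ, s^6 translates into Φ_n^6.

For Φ_d with d a divisor of n, the terms are regular at a primitive d-th root of unity. The sum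
splits into blocks of length d, each a multiple of the first block, which vanishes by the same
antisymmetry (`hasValue_sum_seriesTerm`); the right side vanishes because of [2n]. The terms with m
< k < n carry Φ_n^6, which settles M = n - 1. -/

open Finset

/-! ### Jackson's terminating 8φ7 sum from a contiguous relation -/

section Jackson

variable {F : Type*} [Field F]

/-- The polynomial identity behind the contiguous relation for balanced very-well-poised
`8φ7` series. -/
theorem wellPoised_core (a b c d E f K : F) (ha : a ≠ 0) (hb : b ≠ 0) (hc : c ≠ 0) (hd : d ≠ 0)
    (hf : f ≠ 0) (h : b * c * d * E * f = a ^ 2) :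
    (E - f) * ((1 - a * K) * (1 - b * K) * (1 - c * K) * (1 - d * K) * ((1 - E * K) * (1 - f * K))
      - (1 - K) * (1 - a * K / b) * (1 - a * K / c) * (1 - a * K / d) * ((1 - a * K / E) *
        (1 - a * K / f))) =
    K * (1 - a * K ^ 2) *
      (f * (f - 1) * ((1 - a / (b * f)) * (1 - a / (c * f)) * (1 - a / (d * f))) *
          ((1 - E * K) * (1 - a * K / E)) -
        E * (E - 1) * ((1 - a / (b * E)) * (1 - a / (c * E)) * (1 - a / (d * E))) *
          ((1 - f * K) * (1 - a * K / f))) := by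
  have hE' : E = a ^ 2 / (b * c * d * f) := by field_simp; linear_combination h
  subst hE'
  field_simp
  ring

/-- The start of the telescoping: the k = 0 case of the contiguous relation, where the products are
empty. -/
theorem wellPoised_core_zero (a b c d E f : F) (ha : a ≠ 0) (hb : b ≠ 0) (hc : c ≠ 0) (hd : d ≠ 0)
    (hf : f ≠ 0) (h : b * c * d * E * f = a ^ 2) :
    (E - f) * ((1 - b) * (1 - c) * (1 - d)) =
      E * ((1 - a / (b * E)) * (1 - a / (c * E)) * (1 - a / (d * E))) * (1 - a / f) -
      f * ((1 - a / (b * f)) * (1 - a / (c * f)) * (1 - a / (d * f))) * (1 - a / E) := by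
  have hE' : E = a ^ 2 / (b * c * d * f) := by field_simp; linear_combination h
  subst hE'
  field_simp
  ring

/-- The `i`-th factor `(1 - u Q ^ i) / (1 - a Q ^ (i + 1) / u)` of a well-poised term. -/
def wpFactor (a Q u : F) (i : ℕ) : F := (1 - u * Q ^ i) / (1 - a * Q ^ (i + 1) / u)

/-- The `k`-th term of the very-well-poised series with base `Q` and parameters
`a; b, c, d, e, f`, without the normalization `1 / (1 - a)`. -/
def wpTerm (a b c d e f Q : F) (k : ℕ) : F :=
  (1 - a * (Q ^ k) ^ 2) * Q ^ k * ∏ i ∈ range k,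
    (wpFactor a Q a i * wpFactor a Q b i * wpFactor a Q c i * wpFactor a Q d i *
      (wpFactor a Q e i * wpFactor a Q f i))

/-- The common part of the terms of two contiguous series. -/
def wpCommon (a b c d E f Q : F) (k : ℕ) : F :=
  ∏ i ∈ range k,
    (wpFactor a Q a i * wpFactor a Q b i * wpFactor a Q c i * wpFactor a Q d i *
      ((1 - E * Q ^ (i + 1)) * (1 - f * Q ^ (i + 1)) /
        ((1 - a * Q ^ (i + 1) / E) * (1 - a * Q ^ (i + 1) / f))))

theorem wpTerm_succ (a b c d E f Q : F) (hQ : Q ≠ 0) (hE : E ≠ 0) (k : ℕ) :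
    wpTerm a b c d (E * Q) f Q (k + 1) =
      (1 - a * (Q ^ (k + 1)) ^ 2) * Q ^ (k + 1) * wpCommon a b c d E f Q k *
        (wpFactor a Q a k * wpFactor a Q b k * wpFactor a Q c k * wpFactor a Q d k) *
        ((1 - E * Q ^ (k + 1)) * (1 - f) / ((1 - a / E) * (1 - a * Q ^ (k + 1) / f))) := by
  have h1 (i : ℕ) : wpFactor a Q (E * Q) i = (1 - E * Q ^ (i + 1)) / (1 - a * Q ^ i / E) := by
    unfold wpFactor
    rw [show a * Q ^ (i + 1) / (E * Q) = a * Q ^ i / E by field_simp; ring]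
    congr 1
    ring
  simp only [wpTerm, wpCommon, h1, prod_mul_distrib, prod_div_distrib]
  rw [prod_range_succ (fun i => 1 - E * Q ^ (i + 1)), prod_range_succ' (fun i => 1 - a * Q ^ i / E)]
  simp only [wpFactor, prod_div_distrib]
  rw [prod_range_succ' (fun i => 1 - f * Q ^ i), prod_range_succ (fun i => 1 - a * Q ^ (i + 1) / f)]
  simp only [prod_range_succ, pow_zero, mul_one]
  simp only [div_eq_mul_inv, mul_inv]
  ring

theorem wpTerm_comm (a b c d e f Q : F) (k : ℕ) :
    wpTerm a b c d e f Q k = wpTerm a b c d f e Q k := by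
  simp only [wpTerm, mul_comm (wpFactor a Q e _)]

theorem wpCommon_comm (a b c d E f Q : F) (k : ℕ) :
    wpCommon a b c d E f Q k = wpCommon a b c d f E Q k := by
  simp only [wpCommon]
  refine prod_congr rfl fun i _ => ?_
  congr 2 <;> ring

/-- The inductive step of the telescoping with every factor abstracted to a letter, so that clearing
denominators leaves a multiple of `wellPoised_core`. -/
theorem contiguous_step {α β G Γ t t' X H : F}
    (N0 N1 N2 N3 D0 D1 D2 D3 U0 U1 U2 U3 UE UF DE DF DE0 DF0 W E f A B : F)
    (hD0 : D0 ≠ 0) (hD1 : D1 ≠ 0) (hD2 : D2 ≠ 0) (hD3 : D3 ≠ 0) (hDE : DE ≠ 0) (hDF : DF ≠ 0)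
    (hDE0 : DE0 ≠ 0) (hDF0 : DF0 ≠ 0)
    (hX : X = N0 / D0 * (N1 / D1) * (N2 / D2) * (N3 / D3))
    (hα : α * DF0 = -f * A) (hβ : β * DE0 = -E * B)
    (ht : t = W * H * X * (UE * (1 - f) / (DE0 * DF)))
    (ht' : t' = W * H * X * (UF * (1 - E) / (DF0 * DE)))
    (hG : G = (E - f) * (N0 * N1 * N2 * N3) * H / (DE0 * DF0))
    (hΓ : Γ = (E - f) * (U0 * U1 * U2 * U3) * (H * (X * (UE * UF / (DE * DF)))) / (DE0 * DF0))
    (core : (E - f) * (U0 * U1 * U2 * U3 * (UE * UF) - D0 * D1 * D2 * D3 * (DE * DF)) =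
      W * (f * (f - 1) * A * (UE * DE) - E * (E - 1) * B * (UF * DF))) :
    G + (α * t - β * t') = Γ := by
  have hα' : α = -f * A / DF0 := by rw [← hα]; field_simp
  have hβ' : β = -E * B / DE0 := by rw [← hβ]; field_simp
  rw [hα', hβ', ht, ht', hG, hΓ, hX]
  field_simp
  linear_combination (-H * N0 * N1 * N2 * N3) * core

/-- With these α and β the combination of two contiguous series telescopes. When the series
terminates the right side is zero, and a two-term relation between their sums remains. -/
theorem sum_wpTerm_contiguous (a b c d E f Q α β : F) (ha : a ≠ 0) (hb : b ≠ 0) (hc : c ≠ 0)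
    (hd : d ≠ 0) (hE : E ≠ 0) (hf : f ≠ 0) (hQ : Q ≠ 0) (h : b * c * d * E * f = a ^ 2)
    (hα : α * (1 - a / f) = -f * ((1 - a / (b * f)) * (1 - a / (c * f)) * (1 - a / (d * f))))
    (hβ : β * (1 - a / E) = -E * ((1 - a / (b * E)) * (1 - a / (c * E)) * (1 - a / (d * E))))
    (k : ℕ)
    (h0 : ∀ i ∈ Icc 1 k, 1 - Q ^ i ≠ 0) (h1 : ∀ i ∈ Icc 1 k, 1 - a * Q ^ i / b ≠ 0)
    (h2 : ∀ i ∈ Icc 1 k, 1 - a * Q ^ i / c ≠ 0) (h3 : ∀ i ∈ Icc 1 k, 1 - a * Q ^ i / d ≠ 0)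
    (h4 : ∀ i ≤ k, 1 - a * Q ^ i / E ≠ 0) (h5 : ∀ i ≤ k, 1 - a * Q ^ i / f ≠ 0) :
    ∑ j ∈ range (k + 1), (α * wpTerm a b c d (E * Q) f Q j - β * wpTerm a b c d E (f * Q) Q j) =
      (E - f) * ((1 - a * Q ^ k) * (1 - b * Q ^ k) * (1 - c * Q ^ k) * (1 - d * Q ^ k)) *
        wpCommon a b c d E f Q k / ((1 - a / E) * (1 - a / f)) := by
  have hE0 : 1 - a / E ≠ 0 := by simpa using h4 0 (Nat.zero_le _)
  have hf0 : 1 - a / f ≠ 0 := by simpa using h5 0 (Nat.zero_le _)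
  induction k with
  | zero =>
    simp only [zero_add, sum_range_one, wpTerm, wpCommon, pow_zero, range_zero, prod_empty, mul_one,
      one_pow]
    rw [eq_div_iff (mul_ne_zero hE0 hf0)]
    linear_combination (1 - a) * ((1 - a / E) * hα - (1 - a / f) * hβ -
      wellPoised_core_zero a b c d E f ha hb hc hd hf h)
  | succ k ih =>
    have hle {i : ℕ} (hi : i ∈ Icc 1 k) : i ∈ Icc 1 (k + 1) := by
      simp only [mem_Icc] at hi ⊢; omega
    have hk : k + 1 ∈ Icc 1 (k + 1) := by simp
    rw [sum_range_succ, ih (fun i hi => h0 i (hle hi)) (fun i hi => h1 i (hle hi))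
      (fun i hi => h2 i (hle hi)) (fun i hi => h3 i (hle hi)) (fun i hi => h4 i (by omega))
      (fun i hi => h5 i (by omega))]
    refine contiguous_step (H := wpCommon a b c d E f Q k) (1 - a * Q ^ k) (1 - b * Q ^ k)
      (1 - c * Q ^ k) (1 - d * Q ^ k)
      (1 - Q ^ (k + 1)) (1 - a * Q ^ (k + 1) / b) (1 - a * Q ^ (k + 1) / c)
      (1 - a * Q ^ (k + 1) / d) (1 - a * Q ^ (k + 1)) (1 - b * Q ^ (k + 1)) (1 - c * Q ^ (k + 1))
      (1 - d * Q ^ (k + 1)) (1 - E * Q ^ (k + 1)) (1 - f * Q ^ (k + 1)) (1 - a * Q ^ (k + 1) / E)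
      (1 - a * Q ^ (k + 1) / f) (1 - a / E) (1 - a / f)
      ((1 - a * (Q ^ (k + 1)) ^ 2) * Q ^ (k + 1)) E f _ _ (h0 _ hk)
      (h1 _ hk) (h2 _ hk) (h3 _ hk) (h4 _ le_rfl) (h5 _ le_rfl) hE0 hf0 (X := wpFactor a Q a k *
        wpFactor a Q b k * wpFactor a Q c k * wpFactor a Q d k) ?_ hα hβ
      (wpTerm_succ a b c d E f Q hQ hE k) ?_ rfl ?_ ?_
    · simp only [wpFactor]
      rw [mul_div_cancel_left₀ _ ha]
    · rw [wpTerm_comm, wpTerm_succ a b c d f E Q hQ hf, wpCommon_comm]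
    · rw [wpCommon, prod_range_succ]
      rfl
    · rw [mul_comm (1 - a * (Q ^ (k + 1)) ^ 2)]
      exact wellPoised_core a b c d E f (Q ^ (k + 1)) ha hb hc hd hf h

/-- **Jackson's sum** for a terminating balanced very-well-poised `8φ7` series. -/
theorem jackson_sum (a b c d Q : F) (ha : a ≠ 0) (hb : b ≠ 0) (hc : c ≠ 0) (hd : d ≠ 0)
    (hQ : Q ≠ 0) (n : ℕ) (h0 : ∀ i ∈ Icc 1 n, 1 - Q ^ i ≠ 0)
    (h1 : ∀ i ∈ Icc 1 n, 1 - a * Q ^ i / b ≠ 0) (h2 : ∀ i ∈ Icc 1 n, 1 - a * Q ^ i / c ≠ 0)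
    (h3 : ∀ i ∈ Icc 1 n, 1 - a * Q ^ i / d ≠ 0) (h4 : ∀ i ∈ Icc 1 (2 * n), 1 - a * Q ^ i ≠ 0)
    (h5 : ∀ i ≤ n, 1 - a * Q ^ i / (b * c * d) ≠ 0) (e f : F) (hf : f * Q ^ n = 1)
    (h : b * c * d * e * f = a ^ 2 * Q) :
    (∑ k ∈ range (n + 1), wpTerm a b c d e f Q k) * ∏ i ∈ range n,
        ((1 - a * Q ^ (i + 1) / b) * (1 - a * Q ^ (i + 1) / c) * (1 - a * Q ^ (i + 1) / d) *
          (1 - a * Q ^ (i + 1) / (b * c * d))) =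
      (1 - a) * ∏ i ∈ range n,
        ((1 - a * Q ^ (i + 1)) * ((1 - a * Q ^ (i + 1) / (b * c)) *
          (1 - a * Q ^ (i + 1) / (b * d)) * (1 - a * Q ^ (i + 1) / (c * d)))) := by
  induction n generalizing e f with
  | zero => simp [wpTerm]
  | succ n ih =>
    have hle {i k : ℕ} (hk : k ≤ n + 1) (hi : i ∈ Icc 1 k) : i ∈ Icc 1 (n + 1) := by
      simp only [mem_Icc] at hi ⊢; omega
    have hm : n + 1 ∈ Icc 1 (n + 1) := by simp
    have hf' : f ≠ 0 := left_ne_zero_of_mul_eq_one hf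
    obtain ⟨y, hy⟩ : ∃ y, y = Q ^ (n + 1) := ⟨_, rfl⟩
    have hy0 : y ≠ 0 := hy ▸ pow_ne_zero _ hQ
    have hfy : f = y⁻¹ := eq_inv_of_mul_eq_one_left (hy ▸ hf)
    have he : e = a ^ 2 * y / (b * c * d) * Q := by
      rw [hfy] at h
      field_simp at h ⊢
      linear_combination h
    -- With e = E Q, the series with last parameters (e, f) at level n + 1 is contiguous to the one
    -- with (E, f Q), which terminates at level n.
    obtain ⟨E, hE⟩ : ∃ E, E = a ^ 2 * y / (b * c * d) := ⟨_, rfl⟩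
    rw [← hE] at he
    have hE0 : E ≠ 0 := by
      rw [hE]
      exact div_ne_zero (mul_ne_zero (pow_ne_zero _ ha) hy0)
        (mul_ne_zero (mul_ne_zero hb hc) hd)
    have hay : 1 - a * y ≠ 0 := by
      rw [hy]; exact h4 _ (by simp only [mem_Icc]; omega)
    have hab : 1 - a * y / b ≠ 0 := hy ▸ h1 _ hm
    have hac : 1 - a * y / c ≠ 0 := hy ▸ h2 _ hm
    have had : 1 - a * y / d ≠ 0 := hy ▸ h3 _ hm
    have habcd : 1 - a * y / (b * c * d) ≠ 0 := hy ▸ h5 _ le_rfl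
    have ih' := ih (fun i hi => h0 i (hle (by omega) hi)) (fun i hi => h1 i (hle (by omega) hi))
      (fun i hi => h2 i (hle (by omega) hi)) (fun i hi => h3 i (hle (by omega) hi))
      (fun i hi => h4 i (by simp only [mem_Icc] at hi ⊢; omega)) (fun i hi => h5 i (by omega))
      E (f * Q) (by rw [← hf]; ring) (by rw [← h, he]; ring)
    have key := sum_wpTerm_contiguous a b c d E f Q
      (-f * ((1 - a / (b * f)) * (1 - a / (c * f)) * (1 - a / (d * f))) / (1 - a * y))
      (-f * ((1 - a * y / (b * c)) * (1 - a * y / (b * d)) * (1 - a * y / (c * d))) /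
        (1 - a * y / (b * c * d))) ha hb hc hd hE0 hf' hQ
      (by rw [he] at h; apply mul_right_cancel₀ hQ; rw [← h]; ring)
      (by
        rw [hfy, div_inv_eq_mul, div_mul_cancel₀ _ hay])
      (by
        rw [div_mul_eq_mul_div, div_eq_iff habcd, hE, hfy]
        field_simp
        ring)
      (n + 1) h0 h1 h2 h3
      (by
        intro i hi
        -- a Q^i / E is the reciprocal of a Q^(n+1-i) / (bcd).
        have := h5 (n + 1 - i) (by omega)
        have hyi : y = Q ^ (n + 1 - i) * Q ^ i := by rw [hy, ← pow_add]; congr 1; omega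
        have hQi : Q ^ i ≠ 0 := pow_ne_zero _ hQ
        have hQn : Q ^ (n + 1 - i) ≠ 0 := pow_ne_zero _ hQ
        contrapose! this
        rw [hE, hyi] at this
        field_simp at this ⊢
        linear_combination -this)
      (by
        intro i hi
        rw [hfy, div_inv_eq_mul, hy, mul_assoc, ← pow_add]
        exact h4 _ (by simp only [mem_Icc]; omega))
    -- The factor 1 - f Q^(n+1) kills the boundary term of the telescoping.
    have hz1 : wpCommon a b c d E f Q (n + 1) = 0 := by
      refine prod_eq_zero (i := n) (by simp) ?_
      rw [hf]; simp
    have hz2 : wpTerm a b c d E (f * Q) Q (n + 1) = 0 := by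
      refine mul_eq_zero_of_right _ (prod_eq_zero (i := n) (by simp) ?_)
      have : wpFactor a Q (f * Q) n = 0 := by
        rw [wpFactor, mul_assoc, ← pow_succ', hf]; simp
      rw [this]; simp
    rw [hz1, mul_zero, zero_div, sum_sub_distrib, ← mul_sum, ← mul_sum,
      sum_range_succ (fun j => wpTerm a b c d E (f * Q) Q j), hz2, add_zero, ← he, sub_eq_zero] at key
    rw [prod_range_succ, prod_range_succ, ← hy, ← mul_assoc (1 - a), ← ih']
    have key2 : (∑ k ∈ range (n + 1 + 1), wpTerm a b c d e f Q k) *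
        ((1 - a * y / b) * (1 - a * y / c) * (1 - a * y / d) * (1 - a * y / (b * c * d))) =
        (∑ k ∈ range (n + 1), wpTerm a b c d E (f * Q) Q k) * ((1 - a * y) *
          ((1 - a * y / (b * c)) * (1 - a * y / (b * d)) * (1 - a * y / (c * d)))) := by
      generalize (∑ k ∈ range (n + 1 + 1), wpTerm a b c d e f Q k) = S at key ⊢
      generalize (∑ k ∈ range (n + 1), wpTerm a b c d E (f * Q) Q k) = S' at key ⊢
      have e1 (u : F) : a / (u * f) = a * y / u := by rw [hfy]; field_simp
      rw [e1, e1, e1] at key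
      generalize (1 - a * y / b) = B1 at *
      generalize (1 - a * y / c) = B2 at *
      generalize (1 - a * y / d) = B3 at *
      generalize (1 - a * y / (b * c * d)) = B4 at *
      generalize (1 - a * y / (b * c)) = C1 at *
      generalize (1 - a * y / (b * d)) = C2 at *
      generalize (1 - a * y / (c * d)) = C3 at *
      generalize (1 - a * y) = C4 at *
      field_simp at key
      linear_combination -key
    have e2 (S S' P X Y : F) (h : S * X = S' * Y) : S * (P * X) = S' * P * Y := by
      linear_combination P * h
    exact e2 _ _ _ _ _ key2

end Jackson

/-- The truncated very-well-poised sum with base `q ^ 3` and parameters `q x_j`, multiplied by its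
common denominator; here `y_j` plays the role of `1 / x_j`. -/
def clearedSum {A ι : Type*} [CommRing A] [Fintype ι] (q : A) (x y : ι → A) (m : ℕ) : A :=
  ∑ k ∈ range (m + 1), (1 - q ^ (6 * k + 1)) * q ^ (3 * k) *
    ∏ j, ((∏ i ∈ range k, (1 - q ^ (3 * i + 1) * x j)) *
      ∏ i ∈ Ico k m, (1 - q ^ (3 * i + 3) * y j))

theorem map_clearedSum {A B ι : Type*} [CommRing A] [CommRing B] [Fintype ι] (φ : A →+* B) (q : A)
    (x y : ι → A) (m : ℕ) :
    φ (clearedSum q x y m) = clearedSum (φ q) (fun j => φ (x j)) (fun j => φ (y j)) m := by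
  simp [clearedSum]

/-! ### Antisymmetry of the deformed sum at a root of unity -/

section Reversal

variable {F : Type*} [Field F]

/-- Reflecting the index turns q^(3i+3) into q^(-(3i+1)), and 1 - z⁻¹ = (1 - z)(-z⁻¹). -/
theorem prod_Ico_reversal {q x : F} {m : ℕ} (hq : q ^ (3 * m + 1) = 1) (hx : x ≠ 0) {k l : ℕ}
    (hkl : k + l = m) :
    ∏ i ∈ Ico k m, (1 - q ^ (3 * i + 3) * x⁻¹) =
      (∏ i ∈ range l, (1 - q ^ (3 * i + 1) * x)) * ∏ i ∈ range l, (-(q ^ (3 * i + 1) * x)⁻¹) := by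
  have hq0 : q ≠ 0 := by rintro rfl; simp at hq
  rw [prod_Ico_eq_prod_range, show m - k = l by omega,
    ← prod_range_reflect, ← prod_mul_distrib]
  refine prod_congr rfl fun i hi => ?_
  have hi := mem_range.mp hi
  have h : q ^ (3 * (k + (l - 1 - i)) + 3) * q ^ (3 * i + 1) = 1 := by
    rw [← pow_add, ← hq]; congr 1; omega
  rw [eq_inv_of_mul_eq_one_left h]
  have := pow_ne_zero (3 * i + 1) hq0
  field_simp
  ring

theorem weight_pow (q : F) (l : ℕ) :
    q ^ (9 * l ^ 2) = q ^ (3 * l) * ∏ i ∈ range l, (q ^ (3 * i + 1)) ^ 6 := by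
  induction l with
  | zero => simp
  | succ l ih =>
    rw [prod_range_succ, show 9 * (l + 1) ^ 2 = 9 * l ^ 2 + (18 * l + 9) by ring, pow_add, ih]
    ring

/-- Rests on (3k + 1)^2 - (3l)^2 = (3k + 1 - 3l)(3m + 1), an exponent that is trivial for q. -/
theorem weight_reversal {q : F} {k l m : ℕ} (hq : q ^ (3 * m + 1) = 1) (hkl : k + l = m) :
    (1 - q ^ (6 * k + 1)) * q ^ (3 * k) * ∏ i ∈ range l, ((q ^ (3 * i + 1)) ^ 6)⁻¹ +
      (1 - q ^ (6 * l + 1)) * q ^ (3 * l) * ∏ i ∈ range k, ((q ^ (3 * i + 1)) ^ 6)⁻¹ = 0 := by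
  have hq0 : q ≠ 0 := by rintro rfl; simp at hq
  have hw (l : ℕ) : ∏ i ∈ range l, ((q ^ (3 * i + 1)) ^ 6)⁻¹ = q ^ (3 * l) / q ^ (9 * l ^ 2) := by
    rw [prod_inv_distrib, weight_pow]
    have h1 : ∏ i ∈ range l, (q ^ (3 * i + 1)) ^ 6 ≠ 0 :=
      prod_ne_zero_iff.mpr fun i _ => pow_ne_zero _ (pow_ne_zero _ hq0)
    have h2 := pow_ne_zero (3 * l) hq0
    field_simp
  have key (k l : ℕ) (h : k + l = m) : q ^ (6 * k + 1) * q ^ (9 * k ^ 2) = q ^ (9 * l ^ 2) := by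
    -- The extra power makes both exponents multiples of 3m + 1 without subtraction in ℕ.
    apply mul_right_cancel₀ (pow_ne_zero (3 * l * (3 * k + 1)) hq0)
    rw [← pow_add, ← pow_add, ← pow_add,
      show 6 * k + 1 + 9 * k ^ 2 + 3 * l * (3 * k + 1) = (3 * m + 1) * (3 * k + 1) by subst h; ring,
      show 9 * l ^ 2 + 3 * l * (3 * k + 1) = (3 * m + 1) * (3 * l) by subst h; ring,
      pow_mul, pow_mul, hq, one_pow, one_pow]
  have h1 := key k l hkl
  have h2 := key l k (by omega)
  rw [hw, hw]
  have := pow_ne_zero (9 * l ^ 2) hq0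
  have := pow_ne_zero (9 * k ^ 2) hq0
  rw [← sub_neg_eq_add, ← neg_mul, ← neg_mul]
  field_simp
  linear_combination (q ^ (3 * k) * q ^ (3 * l)) * (-h1 - h2)

/-- If `q ^ (3 m + 1) = 1`, the very-well-poised sum is antisymmetric under `k ↦ m - k`. -/
theorem clearedSum_eq_zero [CharZero F] {ι : Type*} [Fintype ι] (hι : Fintype.card ι = 6) {q : F}
    {x : ι → F} {m : ℕ} (hq : q ^ (3 * m + 1) = 1) (hx : ∏ j, x j = 1) :
    clearedSum q x (fun j => (x j)⁻¹) m = 0 := by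
  have hx0 (j : ι) : x j ≠ 0 := fun h => by
    rw [prod_eq_zero (mem_univ j) h] at hx; exact zero_ne_one hx
  have hterm (k l : ℕ) (h : k + l = m) :
      ∏ j, ((∏ i ∈ range k, (1 - q ^ (3 * i + 1) * x j)) *
        ∏ i ∈ Ico k m, (1 - q ^ (3 * i + 3) * (x j)⁻¹)) =
      (∏ j, ((∏ i ∈ range k, (1 - q ^ (3 * i + 1) * x j)) *
        ∏ i ∈ range l, (1 - q ^ (3 * i + 1) * x j))) *
        ∏ i ∈ range l, ((q ^ (3 * i + 1)) ^ 6)⁻¹ := by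
    simp only [prod_Ico_reversal hq (hx0 _) h, ← mul_assoc]
    rw [prod_mul_distrib]
    congr 1
    rw [prod_comm]
    refine prod_congr rfl fun i _ => ?_
    -- Six parameters give the sign (-1)^6 = 1, and ∏ x_j = 1 removes the x_j from the reversal
    -- factors.
    simp only [mul_inv, neg_eq_neg_one_mul (_ * _), prod_mul_distrib, prod_const, card_univ, hι,
      prod_inv_distrib, hx]
    norm_num
  have hsum : clearedSum q x (fun j => (x j)⁻¹) m + clearedSum q x (fun j => (x j)⁻¹) m = 0 := by
    unfold clearedSum
    nth_rewrite 2 [← sum_range_reflect]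
    rw [← sum_add_distrib]
    refine sum_eq_zero fun k hk => ?_
    have hk := mem_range.mp hk
    have h : k + (m + 1 - 1 - k) = m := by omega
    generalize m + 1 - 1 - k = l at h
    rw [hterm k l h, hterm l k (by omega)]
    simp only [mul_comm (∏ i ∈ range l, (1 - q ^ (3 * i + 1) * x _))]
    linear_combination (∏ j, ((∏ i ∈ range k, (1 - q ^ (3 * i + 1) * x j)) *
        ∏ i ∈ range l, (1 - q ^ (3 * i + 1) * x j))) * weight_reversal hq h
  exact self_eq_neg.mp (eq_neg_of_add_eq_zero_left hsum)

end Reversal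

/-! ### Exponential sums in two variables and their moments -/

section ExponentialSums

open PowerSeries Nat

/-- The power series `exp (a s)`. -/
noncomputable def expMul (a : ℂ) : ℂ⟦X⟧ := rescale a (exp ℂ)

theorem coeff_expMul (a : ℂ) (i : ℕ) : coeff i (expMul a) = a ^ i / i ! := by
  simp [expMul, coeff_rescale, coeff_exp, div_eq_mul_inv]

theorem expMul_add (a b : ℂ) : expMul (a + b) = expMul a * expMul b :=
  (exp_mul_exp_eq_exp_add a b).symm

theorem expMul_zero : expMul 0 = 1 := by
  ext i
  rw [coeff_expMul, coeff_one]
  rcases i with _ | i <;> simp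

theorem expMul_pow (a : ℂ) (k : ℕ) : expMul a ^ k = expMul (k * a) := by
  induction k with
  | zero => simp [expMul_zero]
  | succ k ih => rw [pow_succ, ih, ← expMul_add]; congr 1; push_cast; ring

/-- Finite sums of terms `r exp (a s + b t)`. -/
abbrev ExpSum : Type := AddMonoidAlgebra ℂ (ℂ × ℂ)

/-- The substitution `exp (a s + b t) ↦ exp (ℓ (a, b) s)`. -/
noncomputable def ExpSum.eval (ℓ : ℂ × ℂ →+ ℂ) : ExpSum →ₐ[ℂ] ℂ⟦X⟧ :=
  AddMonoidAlgebra.lift ℂ ℂ⟦X⟧ (ℂ × ℂ)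
    { toFun := fun p => expMul (ℓ p.toAdd)
      map_one' := by simp [expMul_zero]
      map_mul' := fun p p' => by simp [expMul_add] }

theorem ExpSum.eval_single (ℓ : ℂ × ℂ →+ ℂ) (p : ℂ × ℂ) (r : ℂ) :
    ExpSum.eval ℓ (AddMonoidAlgebra.single p r) = r • expMul (ℓ p) := by
  simp [ExpSum.eval]

/-- The functional `r exp (a s + b t) ↦ r a ^ i b ^ j`. -/
noncomputable def ExpSum.moment (i j : ℕ) : ExpSum →+ ℂ :=
  AddMonoidAlgebra.liftNC (AddMonoidHom.id ℂ) fun p => p.toAdd.1 ^ i * p.toAdd.2 ^ j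

theorem ExpSum.moment_single (i j : ℕ) (p : ℂ × ℂ) (r : ℂ) :
    ExpSum.moment i j (AddMonoidAlgebra.single p r) = r * (p.1 ^ i * p.2 ^ j) := by
  simp [ExpSum.moment, AddMonoidAlgebra.liftNC_single]

/-- The substitution `t = c s`. -/
def alongLine (c : ℂ) : ℂ × ℂ →+ ℂ where
  toFun p := p.1 + p.2 * c
  map_zero' := by simp
  map_add' p p' := by simp; ring

/-- Binomial expansion of (a + b c)^i; up to a constant, the moment (j, i - j) is the coefficient of
s^j t^(i-j). -/
theorem ExpSum.coeff_eval_alongLine (c : ℂ) (i : ℕ) (u : ExpSum) :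
    coeff i (ExpSum.eval (alongLine c) u) =
      (∑ j ∈ range (i + 1), ExpSum.moment j (i - j) u * c ^ (i - j) * i.choose j) / i ! := by
  induction u using AddMonoidAlgebra.induction_linear with
  | zero => simp
  | add x y hx hy => simp only [map_add, hx, hy, add_mul, sum_add_distrib, add_div]
  | single p r =>
    rw [ExpSum.eval_single, coeff_smul, coeff_expMul, alongLine]
    simp only [AddMonoidHom.coe_mk, ZeroHom.coe_mk, ExpSum.moment_single]
    rw [add_pow, smul_eq_mul, ← mul_div_assoc, mul_sum]
    congr 1
    refine sum_congr rfl fun j _ => ?_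
    rw [mul_pow]
    ring

theorem ExpSum.moment_zero_eq_zero (u : ExpSum)
    (hu : ExpSum.eval (AddMonoidHom.snd ℂ ℂ) u = 0) (j : ℕ) : ExpSum.moment 0 j u = 0 := by
  have h (u : ExpSum) :
      coeff j (ExpSum.eval (AddMonoidHom.snd ℂ ℂ) u) = ExpSum.moment 0 j u / j ! := by
    induction u using AddMonoidAlgebra.induction_linear with
    | zero => simp
    | add x y hx hy => simp only [map_add, hx, hy, add_div]
    | single p r =>
      rw [ExpSum.eval_single, coeff_smul, coeff_expMul, ExpSum.moment_single, smul_eq_mul]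
      simp [mul_div_assoc]
  have := h u
  rw [hu, map_zero, eq_comm, div_eq_zero_iff] at this
  exact this.resolve_right (by exact_mod_cast j.factorial_ne_zero)

/-- The substitution `t ↦ w t`. -/
noncomputable def ExpSum.rotate (w : ℂ) : ExpSum →+* ExpSum :=
  AddMonoidAlgebra.mapDomainRingHom ℂ
    ((AddMonoidHom.id ℂ).prodMap (AddMonoidHom.mulLeft w))

theorem ExpSum.rotate_single (w : ℂ) (p : ℂ × ℂ) (r : ℂ) :
    ExpSum.rotate w (AddMonoidAlgebra.single p r) =
      AddMonoidAlgebra.single (p.1, w * p.2) r := by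
  simp [ExpSum.rotate, Prod.map]

theorem ExpSum.moment_rotate (w : ℂ) (i j : ℕ) (u : ExpSum) :
    ExpSum.moment i j (ExpSum.rotate w u) = w ^ j * ExpSum.moment i j u := by
  induction u using AddMonoidAlgebra.induction_linear with
  | zero => simp
  | add x y hx hy => simp only [map_add, hx, hy, mul_add]
  | single p r =>
    rw [ExpSum.rotate_single, ExpSum.moment_single, ExpSum.moment_single, mul_pow]
    ring

/-- An exponential sum that vanishes for `s = 0` and is invariant under `t ↦ w t`, where `w` is a
primitive `N`-th root of unity, only changes by a multiple of `s t ^ N` if `t` is replaced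
by `0`. -/
theorem ExpSum.X_pow_dvd_eval_sub {w : ℂ} {N : ℕ} (hw : IsPrimitiveRoot w N) {u : ExpSum}
    (h0 : ExpSum.eval (AddMonoidHom.snd ℂ ℂ) u = 0) (hu : ExpSum.rotate w u = u) (c : ℂ) :
    (X : ℂ⟦X⟧) ^ (N + 1) ∣ ExpSum.eval (alongLine c) u - ExpSum.eval (alongLine 0) u := by
  rw [X_pow_dvd_iff]
  intro i hi
  rw [map_sub, ExpSum.coeff_eval_alongLine, ExpSum.coeff_eval_alongLine, sub_eq_zero]
  congr 1
  refine sum_congr rfl fun j hj => ?_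
  have hj := mem_range.mp hj
  rcases Nat.eq_zero_or_pos (i - j) with h | h
  · simp [h]
  -- Moments with j = 0 vanish because u is zero at s = 0. If j > 0 then 0 < i - j < N, so w^(i-j) ≠
  -- 1 and rotation invariance kills the moment.
  have hm : ExpSum.moment j (i - j) u = 0 := by
    rcases Nat.eq_zero_or_pos j with rfl | hj0
    · exact ExpSum.moment_zero_eq_zero u h0 _
    · have h1 := ExpSum.moment_rotate w j (i - j) u
      rw [hu] at h1
      have h2 : w ^ (i - j) ≠ 1 := hw.pow_ne_one_of_pos_of_lt h.ne' (by omega)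
      have h3 : (w ^ (i - j) - 1) * ExpSum.moment j (i - j) u = 0 := by linear_combination -h1
      exact (mul_eq_zero.mp h3).resolve_left (sub_ne_zero.mpr h2)
  simp [hm]

end ExponentialSums

/-! ### Jackson's sum with denominators cleared -/

section ClearedJackson

theorem wpFactor_cube {F : Type*} [Field F] {q x : F} (hq : q ≠ 0) (hx : x ≠ 0) (i : ℕ) :
    wpFactor q (q ^ 3) (q * x) i = (1 - q ^ (3 * i + 1) * x) / (1 - q ^ (3 * i + 3) * x⁻¹) := by
  unfold wpFactor
  rw [← pow_mul, ← pow_mul]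
  congr 2
  · ring
  · field_simp
    ring

/-- The condition x_0 = 1 reflects that a = q itself is a numerator parameter of the
very-well-poised series. -/
theorem clearedSum_eq_sum_wpTerm {F : Type*} [Field F] {q : F} (x : Fin 6 → F) (m : ℕ)
    (hq : q ≠ 0) (hx : ∀ j, x j ≠ 0) (hx0 : x 0 = 1)
    (hD : ∀ i < m, ∀ j, 1 - q ^ (3 * i + 3) * (x j)⁻¹ ≠ 0) :
    clearedSum q x (fun j => (x j)⁻¹) m =
      (∑ k ∈ range (m + 1), wpTerm q (q * x 1) (q * x 2) (q * x 3) (q * x 4) (q * x 5) (q ^ 3) k) *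
        ∏ j, ∏ i ∈ range m, (1 - q ^ (3 * i + 3) * (x j)⁻¹) := by
  rw [clearedSum, sum_mul]
  refine sum_congr rfl fun k hk => ?_
  have hk : k ≤ m := by have := mem_range.mp hk; omega
  have h1 : ∏ i ∈ range k, (wpFactor q (q ^ 3) q i * wpFactor q (q ^ 3) (q * x 1) i *
      wpFactor q (q ^ 3) (q * x 2) i * wpFactor q (q ^ 3) (q * x 3) i *
      (wpFactor q (q ^ 3) (q * x 4) i * wpFactor q (q ^ 3) (q * x 5) i)) =
      ∏ j, ∏ i ∈ range k, (1 - q ^ (3 * i + 1) * x j) / (1 - q ^ (3 * i + 3) * (x j)⁻¹) := by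
    rw [prod_comm]
    refine prod_congr rfl fun i _ => ?_
    have h0 : wpFactor q (q ^ 3) q i = wpFactor q (q ^ 3) (q * x 0) i := by rw [hx0, mul_one]
    rw [h0, Fin.prod_univ_six]
    simp only [wpFactor_cube hq (hx _)]
    ring
  rw [wpTerm, h1, mul_assoc _ (∏ j, _), ← prod_mul_distrib]
  congr 1
  · rw [← pow_mul, ← pow_mul, ← pow_mul, ← pow_succ']
    congr 3
    ring
  · refine prod_congr rfl fun j _ => ?_
    rw [← prod_range_mul_prod_Ico _ hk, ← mul_assoc, ← prod_mul_distrib]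
    congr 1
    refine prod_congr rfl fun i hi => ?_
    rw [div_mul_cancel₀ _ (hD i (by have := mem_range.mp hi; omega) j)]

/-- Jackson's sum with Q = q^3, a = q and b, …, f = q x_1, …, q x_5: `hprod` is the balancing
condition, and `hx5` says f = Q^(-m). -/
theorem clearedSum_mul_eq_of_field {F : Type*} [Field F] {q : F} (x : Fin 6 → F) (m : ℕ)
    (hq : q ≠ 0) (hx : ∀ j, x j ≠ 0) (hx0 : x 0 = 1) (hprod : x 1 * x 2 * x 3 * x 4 * x 5 = 1)
    (hx5 : q ^ (3 * m + 1) * x 5 = 1)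
    (hD : ∀ i < m, ∀ j, 1 - q ^ (3 * i + 3) * (x j)⁻¹ ≠ 0)
    (hq1 : ∀ i, 1 - q ^ (i + 1) ≠ 0)
    (hx123 : ∀ i, q ^ (3 * i) - q ^ 2 * (x 1 * x 2 * x 3) ≠ 0) :
    clearedSum q x (fun j => (x j)⁻¹) m *
        ∏ i ∈ range m, (1 - q ^ (3 * i + 1) * ((x 1)⁻¹ * (x 2)⁻¹ * (x 3)⁻¹)) =
      (1 - q ^ (3 * m + 1)) * ∏ i ∈ range m,
        ((1 - q ^ (3 * i + 3)) * ((1 - q ^ (3 * i + 1)) * (1 - q ^ (3 * i + 3) * (x 4)⁻¹) *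
          (1 - q ^ (3 * i + 3) * (x 5)⁻¹) * ((1 - q ^ (3 * i + 2) * ((x 1)⁻¹ * (x 2)⁻¹)) *
          (1 - q ^ (3 * i + 2) * ((x 1)⁻¹ * (x 3)⁻¹)) *
          (1 - q ^ (3 * i + 2) * ((x 2)⁻¹ * (x 3)⁻¹))))) := by
  have e1 (i : ℕ) (j : Fin 6) : q * (q ^ 3) ^ i / (q * x j) = q ^ (3 * i) * (x j)⁻¹ := by
    have := hx j
    rw [← pow_mul]; field_simp
  have e2 (i : ℕ) (j k : Fin 6) :
      q * (q ^ 3) ^ (i + 1) / (q * x j * (q * x k)) = q ^ (3 * i + 2) * ((x j)⁻¹ * (x k)⁻¹) := by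
    have := hx j; have := hx k
    rw [← pow_mul]; field_simp; ring
  have e3 (i : ℕ) : q * (q ^ 3) ^ (i + 1) / (q * x 1 * (q * x 2) * (q * x 3)) =
      q ^ (3 * i + 1) * ((x 1)⁻¹ * (x 2)⁻¹ * (x 3)⁻¹) := by
    have := hx 1; have := hx 2; have := hx 3
    rw [← pow_mul]; field_simp; ring
  have hden (j : Fin 6) (i : ℕ) (hi : i ∈ Icc 1 m) : 1 - q * (q ^ 3) ^ i / (q * x j) ≠ 0 := by
    rw [mem_Icc] at hi
    obtain ⟨i, rfl⟩ : ∃ i', i = i' + 1 := ⟨i - 1, by omega⟩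
    rw [e1]
    exact hD i (by omega) j
  have hJ := jackson_sum q (q * x 1) (q * x 2) (q * x 3) (q ^ 3) hq (mul_ne_zero hq (hx _))
    (mul_ne_zero hq (hx _)) (mul_ne_zero hq (hx _)) (pow_ne_zero _ hq) m
    (fun i hi => by
      rw [mem_Icc] at hi
      obtain ⟨i, rfl⟩ : ∃ i', i = i' + 1 := ⟨i - 1, by omega⟩
      rw [← pow_mul]
      exact hq1 (3 * i + 2))
    (hden 1) (hden 2) (hden 3)
    (fun i _ => by rw [← pow_mul, ← pow_succ']; exact hq1 _)
    (fun i _ => by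
      intro h
      apply hx123 i
      have := hx 1; have := hx 2; have := hx 3
      rw [← pow_mul] at h
      field_simp at h
      linear_combination -h)
    (q * x 4) (q * x 5) (by rw [← hx5, ← pow_mul, pow_succ]; ring)
    (by linear_combination q ^ 5 * hprod)
  simp only [e1, e2, e3, show ∀ i, 3 * (i + 1) = 3 * i + 3 from fun i => by ring] at hJ
  rw [clearedSum_eq_sum_wpTerm x m hq hx hx0 hD, Fin.prod_univ_six, hx0]
  -- The index shift by one in (a Q; Q)_m releases the factor 1 - q^(3m+1).
  have hs : (1 - q) * ∏ i ∈ range m, (1 - q * (q ^ 3) ^ (i + 1)) =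
      (∏ i ∈ range m, (1 - q ^ (3 * i + 1))) * (1 - q ^ (3 * m + 1)) := by
    rw [← prod_range_succ (fun i => 1 - q ^ (3 * i + 1)), prod_range_succ', mul_comm]
    congr 1
    · refine prod_congr rfl fun i _ => ?_
      rw [← pow_mul, ← pow_succ']
    · simp
  simp only [prod_mul_distrib, inv_one, mul_one] at hJ ⊢
  generalize ∏ i ∈ range m, (1 - q * (q ^ 3) ^ (i + 1)) = R1 at *
  generalize ∏ i ∈ range m, (1 - q ^ (3 * i + 1)) = R2 at *
  linear_combination ((∏ i ∈ range m, (1 - q ^ (3 * i + 3))) *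
    (∏ i ∈ range m, (1 - q ^ (3 * i + 3) * (x 4)⁻¹)) *
    (∏ i ∈ range m, (1 - q ^ (3 * i + 3) * (x 5)⁻¹))) * (hJ + (
      (∏ i ∈ range m, (1 - q ^ (3 * i + 2) * ((x 1)⁻¹ * (x 2)⁻¹))) *
      (∏ i ∈ range m, (1 - q ^ (3 * i + 2) * ((x 1)⁻¹ * (x 3)⁻¹))) *
      (∏ i ∈ range m, (1 - q ^ (3 * i + 2) * ((x 2)⁻¹ * (x 3)⁻¹)))) * hs)

/-- Jackson's sum for the base `q ^ 3` and the parameters `q x_j`, with denominators cleared. -/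
theorem clearedSum_mul_eq {A : Type*} [CommRing A] [IsDomain A] {q : A} (x y : Fin 6 → A) (m : ℕ)
    (hq : q ≠ 0) (hxy : ∀ j, x j * y j = 1) (hx0 : x 0 = 1)
    (hprod : x 1 * x 2 * x 3 * x 4 * x 5 = 1) (hx5 : q ^ (3 * m + 1) * x 5 = 1)
    (hD : ∀ i < m, ∀ j, 1 - q ^ (3 * i + 3) * y j ≠ 0)
    (hq1 : ∀ i, 1 - q ^ (i + 1) ≠ 0)
    (hx123 : ∀ i, q ^ (3 * i) - q ^ 2 * (x 1 * x 2 * x 3) ≠ 0) :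
    clearedSum q x y m * ∏ i ∈ range m, (1 - q ^ (3 * i + 1) * (y 1 * y 2 * y 3)) =
      (1 - q ^ (3 * m + 1)) * ∏ i ∈ range m,
        ((1 - q ^ (3 * i + 3)) * ((1 - q ^ (3 * i + 1)) * (1 - q ^ (3 * i + 3) * y 4) *
          (1 - q ^ (3 * i + 3) * y 5) * ((1 - q ^ (3 * i + 2) * (y 1 * y 2)) *
          (1 - q ^ (3 * i + 2) * (y 1 * y 3)) * (1 - q ^ (3 * i + 2) * (y 2 * y 3))))) := by
  let φ := algebraMap A (FractionRing A)
  have hφ : Function.Injective φ := IsFractionRing.injective A (FractionRing A)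
  have hne {a : A} (h : a ≠ 0) : φ a ≠ 0 := (map_ne_zero_iff φ hφ).mpr h
  have hy (j : Fin 6) : (φ (x j))⁻¹ = φ (y j) :=
    inv_eq_of_mul_eq_one_right (by rw [← map_mul, hxy, map_one])
  have hx (j : Fin 6) : φ (x j) ≠ 0 := hne (left_ne_zero_of_mul_eq_one (hxy j))
  have h := clearedSum_mul_eq_of_field (q := φ q) (fun j => φ (x j)) m (hne hq) hx
    (by simp [hx0]) (by simp only [← map_mul, hprod, map_one])
    (by simp only [← map_mul, ← map_pow, hx5, map_one])
    (fun i hi j => by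
      simp only [hy]; simpa using hne (hD i hi j))
    (fun i => by simpa using hne (hq1 i))
    (fun i => by simpa using hne (hx123 i))
  simp only [hy] at h
  apply hφ
  rw [map_mul, map_clearedSum]
  simpa using h

end ClearedJackson

/-! ### First-order comparison of the two closed forms -/

section FirstOrder

open PowerSeries Nat

/-- `f = v (1 + l s) + O(s ^ 2)`. -/
def HasJet (f : ℂ⟦X⟧) (v l : ℂ) : Prop := coeff 0 f = v ∧ coeff 1 f = v * l

/-- The number l is a logarithmic derivative, hence additive; this reduces products to sums. -/
theorem HasJet.mul {f g : ℂ⟦X⟧} {v l v' l' : ℂ} (hf : HasJet f v l) (hg : HasJet g v' l') :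
    HasJet (f * g) (v * v') (l + l') := by
  obtain ⟨h0, h1⟩ := hf
  obtain ⟨h0', h1'⟩ := hg
  constructor
  · rw [coeff_zero_eq_constantCoeff_apply] at *
    rw [map_mul, h0, h0']
  · rw [coeff_one_mul, ← coeff_zero_eq_constantCoeff_apply, ← coeff_zero_eq_constantCoeff_apply,
      h0, h0', h1, h1']
    ring

theorem HasJet.one : HasJet 1 1 0 := by simp [HasJet, coeff_one]

theorem HasJet.prod {ι : Type*} {f : ι → ℂ⟦X⟧} {v l : ι → ℂ} (s : Finset ι)
    (h : ∀ i ∈ s, HasJet (f i) (v i) (l i)) :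
    HasJet (∏ i ∈ s, f i) (∏ i ∈ s, v i) (∑ i ∈ s, l i) := by
  classical
  induction s using Finset.induction_on with
  | empty => simpa using HasJet.one
  | insert a s ha ih =>
    rw [prod_insert ha, prod_insert ha, sum_insert ha]
    exact (h a (mem_insert_self a s)).mul (ih fun i hi => h i (mem_insert_of_mem hi))

theorem HasJet.X_sq_dvd_sub {f g : ℂ⟦X⟧} {v l v' l' : ℂ} (hf : HasJet f v l)
    (hg : HasJet g v' l') (hv : v = v') (hl : l = l') : X ^ 2 ∣ f - g := by
  rw [X_pow_dvd_iff]
  intro i hi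
  rw [map_sub, sub_eq_zero]
  interval_cases i
  · rw [hf.1, hg.1, hv]
  · rw [hf.2, hg.2, hv, hl]

theorem HasJet.one_sub {z : ℂ} (hz : z ≠ 1) (α : ℂ) :
    HasJet (1 - C z * expMul α) (1 - z) (-(α * (z / (1 - z)))) := by
  have : 1 - z ≠ 0 := sub_ne_zero.mpr hz.symm
  constructor
  · rw [map_sub, coeff_C_mul, coeff_expMul]
    simp
  · rw [map_sub, coeff_C_mul, coeff_expMul, coeff_one]
    field_simp
    simp

theorem exists_hasJet_one_sub_expMul (α : ℂ) :
    ∃ h, 1 - expMul α = X * h ∧ HasJet h (-α) (α / 2) := by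
  refine ⟨.mk fun i => -(α ^ (i + 1) / (i + 1)!), ?_, ?_⟩
  · ext i
    rw [map_sub, coeff_expMul, coeff_one]
    rcases i with _ | i
    · simp
    · rw [coeff_succ_X_mul, coeff_mk]; simp
  · constructor
    · simp [coeff_mk]
    · simp [coeff_mk]; ring

/-- The product `∏ (1 - ζ ^ (3 i + r) exp ((3 i + r + δ) s))`, that is
`(q ^ r exp (δ s); q ^ 3)_m` for `q = ζ exp s`. -/
noncomputable def shiftedExp (ζ : ℂ) (r m : ℕ) (δ : ℂ) : ℂ⟦X⟧ :=
  ∏ i ∈ range m, (1 - C (ζ ^ (3 * i + r)) * expMul ((3 * i + r : ℕ) + δ))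

theorem HasJet.prod_one_sub {ζ : ℂ} {r : ℕ} (s : Finset ℕ) (h : ∀ i ∈ s, ζ ^ (3 * i + r) ≠ 1)
    (δ : ℂ) :
    HasJet (∏ i ∈ s, (1 - C (ζ ^ (3 * i + r)) * expMul ((3 * i + r : ℕ) + δ)))
      (∏ i ∈ s, (1 - ζ ^ (3 * i + r)))
      ((∑ i ∈ s, -((3 * i + r : ℕ) * (ζ ^ (3 * i + r) / (1 - ζ ^ (3 * i + r))))) -
        δ * ∑ i ∈ s, ζ ^ (3 * i + r) / (1 - ζ ^ (3 * i + r))) := by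
  convert! HasJet.prod s (fun i hi => HasJet.one_sub (h i hi) ((3 * i + r : ℕ) + δ)) using 1
  rw [mul_sum, ← sum_sub_distrib]
  refine sum_congr rfl fun i _ => by ring

theorem shiftedExp_hasJet {ζ : ℂ} {r m : ℕ} (h : ∀ i < m, ζ ^ (3 * i + r) ≠ 1) (δ : ℂ) :
    HasJet (shiftedExp ζ r m δ) (∏ i ∈ range m, (1 - ζ ^ (3 * i + r)))
      ((∑ i ∈ range m, -((3 * i + r : ℕ) * (ζ ^ (3 * i + r) / (1 - ζ ^ (3 * i + r))))) -
        δ * ∑ i ∈ range m, ζ ^ (3 * i + r) / (1 - ζ ^ (3 * i + r))) :=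
  HasJet.prod_one_sub _ (fun i hi => h i (mem_range.mp hi)) δ

/-- Exactly the factor i = t vanishes at s = 0, being 1 - exp((n + δ) s) with n = 3t + 2; v and l
come from the other factors and do not depend on δ. -/
theorem exists_shiftedExp_two {ζ : ℂ} {t : ℕ} (h0 : ζ ^ (3 * t + 2) = 1)
    (h : ∀ i ∈ (range (2 * t + 1)).erase t, ζ ^ (3 * i + 2) ≠ 1) :
    ∃ v l, ∀ δ, ∃ V, shiftedExp ζ 2 (2 * t + 1) δ = X * V ∧
      HasJet V (-((3 * t + 2 : ℕ) + δ) * v) (((3 * t + 2 : ℕ) + δ) / 2 + (l -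
        δ * ∑ i ∈ (range (2 * t + 1)).erase t, ζ ^ (3 * i + 2) / (1 - ζ ^ (3 * i + 2)))) := by
  refine ⟨∏ i ∈ (range (2 * t + 1)).erase t, (1 - ζ ^ (3 * i + 2)),
    ∑ i ∈ (range (2 * t + 1)).erase t,
      -((3 * i + 2 : ℕ) * (ζ ^ (3 * i + 2) / (1 - ζ ^ (3 * i + 2)))), fun δ => ?_⟩
  obtain ⟨g, hg, hg'⟩ := exists_hasJet_one_sub_expMul ((3 * t + 2 : ℕ) + δ)
  refine ⟨_, ?_, hg'.mul (HasJet.prod_one_sub _ h δ)⟩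
  rw [shiftedExp, ← mul_prod_erase _ _ (show t ∈ range (2 * t + 1) by simp; omega), h0, map_one,
    one_mul, hg, mul_assoc]

/-- This reflection identity evaluates the logarithmic derivatives below by pairing indices. -/
theorem div_one_sub_add {F : Type*} [Field F] {z z' : F} (h : z * z' = 1) (hz : z ≠ 1) :
    z / (1 - z) + z' / (1 - z') = -1 := by
  have h0 : z ≠ 0 := left_ne_zero_of_mul_eq_one h
  have h1 : 1 - z ≠ 0 := sub_ne_zero.mpr hz.symm
  have h2 : z - 1 ≠ 0 := sub_ne_zero.mpr hz
  rw [eq_inv_of_mul_eq_one_right h]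
  field_simp
  ring

theorem sum_div_one_sub_one_add_three {ζ : ℂ} {m : ℕ} (h0 : ζ ^ (3 * m + 1) = 1)
    (h : ∀ i < m, ζ ^ (3 * i + 1) ≠ 1) :
    ∑ i ∈ range m, ζ ^ (3 * i + 1) / (1 - ζ ^ (3 * i + 1)) +
      ∑ i ∈ range m, ζ ^ (3 * i + 3) / (1 - ζ ^ (3 * i + 3)) = -m := by
  rw [← sum_range_reflect (fun i => ζ ^ (3 * i + 3) / (1 - ζ ^ (3 * i + 3))), ← sum_add_distrib]
  rw [sum_congr rfl (fun i hi => div_one_sub_add (z := ζ ^ (3 * i + 1))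
    (z' := ζ ^ (3 * (m - 1 - i) + 3)) ?_ (h i (mem_range.mp hi)))]
  · simp
  · have := mem_range.mp hi
    rw [← pow_add, ← h0]
    congr 1
    omega

theorem sum_div_one_sub_two {ζ : ℂ} {t : ℕ} (h0 : ζ ^ (3 * t + 2) = 1)
    (h : ∀ i ∈ (range (2 * t + 1)).erase t, ζ ^ (3 * i + 2) ≠ 1) :
    ∑ i ∈ (range (2 * t + 1)).erase t, ζ ^ (3 * i + 2) / (1 - ζ ^ (3 * i + 2)) = -t := by
  have hr : ∑ i ∈ (range (2 * t + 1)).erase t, ζ ^ (3 * i + 2) / (1 - ζ ^ (3 * i + 2)) =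
      ∑ i ∈ (range (2 * t + 1)).erase t,
        ζ ^ (3 * (2 * t - i) + 2) / (1 - ζ ^ (3 * (2 * t - i) + 2)) := by
    refine sum_nbij' (fun i => 2 * t - i) (fun i => 2 * t - i) ?_ ?_ ?_ ?_ ?_ <;> intro i hi <;>
      simp only [mem_erase, mem_range] at hi ⊢
    · omega
    · omega
    · omega
    · omega
    · rw [show 2 * t - (2 * t - i) = i by omega]
  have h2 : ∑ i ∈ (range (2 * t + 1)).erase t, ζ ^ (3 * i + 2) / (1 - ζ ^ (3 * i + 2)) +
      ∑ i ∈ (range (2 * t + 1)).erase t, ζ ^ (3 * i + 2) / (1 - ζ ^ (3 * i + 2)) = -(2 * t) := by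
    nth_rewrite 2 [hr]
    rw [← sum_add_distrib, sum_congr rfl (fun i hi => div_one_sub_add (z := ζ ^ (3 * i + 2))
      (z' := ζ ^ (3 * (2 * t - i) + 2)) ?_ (h i hi))]
    · rw [sum_const, card_erase_of_mem (by simp; omega), card_range]
      simp
    · simp only [mem_erase, mem_range] at hi
      rw [← pow_add, show 3 * i + 2 + (3 * (2 * t - i) + 2) = (3 * t + 2) * 2 by omega, pow_mul, h0,
        one_pow]
  linear_combination h2 / 2

/-- Both sides carry X^3 from their three products with r = 2, so agreement of the cofactors modulo
X^2 suffices. Leading coefficients differ by the factor 5 supplied on the right, and the logarithmic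
derivatives agree by the two reflection sums. -/
theorem X_pow_dvd_shiftedExp_sub {ζ w : ℂ} {t : ℕ} (hζ : IsPrimitiveRoot ζ (3 * t + 2))
    (hw : 1 + w + w ^ 2 + w ^ 3 + w ^ 4 = 0) :
    X ^ 5 ∣ shiftedExp ζ 1 (2 * t + 1) 0 *
      shiftedExp ζ 3 (2 * t + 1) (2 * (3 * t + 2 : ℕ) * w ^ 4) *
      shiftedExp ζ 3 (2 * t + 1) (2 * (3 * t + 2 : ℕ)) *
      (shiftedExp ζ 2 (2 * t + 1) (2 * (3 * t + 2 : ℕ) * (w + w ^ 2)) *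
        shiftedExp ζ 2 (2 * t + 1) (2 * (3 * t + 2 : ℕ) * (w + w ^ 3)) *
        shiftedExp ζ 2 (2 * t + 1) (2 * (3 * t + 2 : ℕ) * (w ^ 2 + w ^ 3))) -
      5 * shiftedExp ζ 2 (2 * t + 1) 0 ^ 3 * shiftedExp ζ 3 (2 * t + 1) 0 ^ 2 *
        shiftedExp ζ 1 (2 * t + 1) (2 * (3 * t + 2 : ℕ) * (w + w ^ 2 + w ^ 3)) := by
  have hne (k : ℕ) (h : ¬ (3 * t + 2) ∣ k) : ζ ^ k ≠ 1 := fun h' => h ((hζ.pow_eq_one_iff_dvd k).mp h')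
  have hndvd (k : ℕ) (h1 : 0 < k) (h2 : k < 2 * (3 * t + 2)) (h3 : k ≠ 3 * t + 2) :
      ¬ (3 * t + 2) ∣ k := by
    rintro ⟨j, rfl⟩
    have : j < 2 := by by_contra hj; nlinarith
    interval_cases j <;> omega
  have n1 (i : ℕ) (hi : i < 2 * t + 1) : ζ ^ (3 * i + 1) ≠ 1 :=
    hne _ (hndvd _ (by omega) (by omega) (by omega))
  have n3 (i : ℕ) (hi : i < 2 * t + 1) : ζ ^ (3 * i + 3) ≠ 1 := by
    refine hne _ fun h => ?_
    rw [show 3 * i + 3 = 3 * (i + 1) by ring] at h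
    have hc : Nat.Coprime (3 * t + 2) 3 := by
      rw [Nat.coprime_comm, Nat.coprime_mul_left_add_right]; norm_num
    exact absurd (Nat.le_of_dvd (by omega) (hc.dvd_of_dvd_mul_left h)) (by omega)
  have n2 : ∀ i ∈ (range (2 * t + 1)).erase t, ζ ^ (3 * i + 2) ≠ 1 := fun i hi => by
    simp only [mem_erase, mem_range] at hi
    exact hne _ (hndvd _ (by omega) (by omega) (by omega))
  have j1 (δ : ℂ) := shiftedExp_hasJet n1 δ
  have j3 (δ : ℂ) := shiftedExp_hasJet n3 δ
  obtain ⟨v, l, j2⟩ := exists_shiftedExp_two hζ.pow_eq_one n2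
  have G13 := sum_div_one_sub_one_add_three (m := 2 * t + 1)
    (by rw [show 3 * (2 * t + 1) + 1 = (3 * t + 2) * 2 by ring, pow_mul, hζ.pow_eq_one, one_pow]) n1
  rw [sum_div_one_sub_two hζ.pow_eq_one n2] at j2
  obtain ⟨A, hA, hA'⟩ := j2 (2 * (3 * t + 2 : ℕ) * (w + w ^ 2))
  obtain ⟨B, hB, hB'⟩ := j2 (2 * (3 * t + 2 : ℕ) * (w + w ^ 3))
  obtain ⟨D, hD, hD'⟩ := j2 (2 * (3 * t + 2 : ℕ) * (w ^ 2 + w ^ 3))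
  obtain ⟨E, hE, hE'⟩ := j2 0
  rw [hA, hB, hD, hE]
  have h5 : HasJet 5 5 0 := by
    rw [show (5 : ℂ⟦X⟧) = C 5 from (map_ofNat C 5).symm]
    constructor <;> rw [coeff_C] <;> simp
  have key := (((j1 0).mul (j3 (2 * (3 * t + 2 : ℕ) * w ^ 4))).mul (j3 (2 * (3 * t + 2 : ℕ)))).mul
    ((hA'.mul hB').mul hD') |>.X_sq_dvd_sub ((h5.mul ((hE'.mul hE').mul hE')).mul
      ((j3 0).mul (j3 0)) |>.mul (j1 (2 * (3 * t + 2 : ℕ) * (w + w ^ 2 + w ^ 3)))) ?_ ?_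
  · obtain ⟨f, hf⟩ := key
    exact ⟨f, by linear_combination X ^ 3 * hf⟩
  · have h5' : (1 + 2 * (w + w ^ 2)) * (1 + 2 * (w + w ^ 3)) * (1 + 2 * (w ^ 2 + w ^ 3)) = 5 := by
      linear_combination (-4 + 8 * w + 4 * w ^ 2 + 8 * w ^ 3 + 8 * w ^ 4) * hw
    linear_combination (-(3 * t + 2 : ℕ) ^ 3 : ℂ) * v ^ 3 *
      (∏ i ∈ range (2 * t + 1), (1 - ζ ^ (3 * i + 1))) *
      (∏ i ∈ range (2 * t + 1), (1 - ζ ^ (3 * i + 3))) ^ 2 * h5'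
  · generalize ∑ i ∈ range (2 * t + 1), ζ ^ (3 * i + 1) / (1 - ζ ^ (3 * i + 1)) = g1 at *
    generalize ∑ i ∈ range (2 * t + 1), ζ ^ (3 * i + 3) / (1 - ζ ^ (3 * i + 3)) = g3 at *
    push_cast at G13 ⊢
    linear_combination (-2 * (3 * t + 2) * g3) * hw +
      2 * (3 * t + 2) * (w + w ^ 2 + w ^ 3) * G13

end FirstOrder

/-! ### The congruence modulo s^6 at a primitive n-th root of unity -/

section LocalExpansion

open PowerSeries

theorem clearedSum_eq_zero_of_isDomain {A ι : Type*} [CommRing A] [IsDomain A] [CharZero A]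
    [Fintype ι] (hι : Fintype.card ι = 6) {q : A} {x y : ι → A} {m : ℕ}
    (hq : q ^ (3 * m + 1) = 1) (hxy : ∀ j, x j * y j = 1) (hx : ∏ j, x j = 1) :
    clearedSum q x y m = 0 := by
  obtain ⟨φ, hφ⟩ : ∃ φ : A →+* FractionRing A, Function.Injective φ :=
    ⟨algebraMap A (FractionRing A), IsFractionRing.injective A (FractionRing A)⟩
  have : CharZero (FractionRing A) := charZero_of_injective_ringHom hφ
  apply hφ
  rw [map_clearedSum, map_zero]
  have hy (j : ι) : φ (y j) = (φ (x j))⁻¹ :=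
    (inv_eq_of_mul_eq_one_right (by rw [← map_mul, hxy, map_one])).symm
  simp only [hy]
  exact clearedSum_eq_zero hι (by rw [← map_pow, hq, map_one]) (by rw [← map_prod, hx, map_one])

/-- The exponents `0, w, w ^ 2, w ^ 3, w ^ 4, 1`. -/
def rootExponent (w : ℂ) : Fin 6 → ℂ := ![0, w, w ^ 2, w ^ 3, w ^ 4, 1]

theorem sum_rootExponent {w : ℂ} (hw : 1 + w + w ^ 2 + w ^ 3 + w ^ 4 = 0) :
    ∑ j, rootExponent w j = 0 := by
  rw [Fin.sum_univ_six]
  simp only [rootExponent, Matrix.cons_val]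
  linear_combination hw

/-- The deformed sum, as an exponential sum in two variables. -/
noncomputable def deformedSum (ζ w : ℂ) (m : ℕ) : ExpSum :=
  clearedSum (AddMonoidAlgebra.single (1, 0) ζ)
    (fun j => AddMonoidAlgebra.single (0, rootExponent w j) 1)
    (fun j => AddMonoidAlgebra.single (0, -rootExponent w j) 1) m

theorem eval_deformedSum (ℓ : ℂ × ℂ →+ ℂ) (ζ w : ℂ) (m : ℕ) :
    ExpSum.eval ℓ (deformedSum ζ w m) = clearedSum (C ζ * expMul (ℓ (1, 0)))
      (fun j => expMul (ℓ (0, rootExponent w j))) (fun j => expMul (ℓ (0, -rootExponent w j)))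
      m := by
  have := map_clearedSum (ExpSum.eval ℓ : ExpSum →+* ℂ⟦X⟧) (AddMonoidAlgebra.single (1, 0) ζ)
    (fun j => AddMonoidAlgebra.single (0, rootExponent w j) 1)
    (fun j => AddMonoidAlgebra.single (0, -rootExponent w j) 1) m
  simp only [RingHom.coe_coe, ExpSum.eval_single, one_smul, smul_eq_C_mul] at this
  exact this

theorem prod_expMul {ι : Type*} (s : Finset ι) (f : ι → ℂ) :
    ∏ i ∈ s, expMul (f i) = expMul (∑ i ∈ s, f i) := by
  classical
  induction s using Finset.induction_on with
  | empty => simp [expMul_zero]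
  | insert a s ha ih => rw [prod_insert ha, sum_insert ha, expMul_add, ih]

theorem eval_snd_deformedSum {ζ w : ℂ} {m : ℕ} (hζ : ζ ^ (3 * m + 1) = 1)
    (hw : 1 + w + w ^ 2 + w ^ 3 + w ^ 4 = 0) :
    ExpSum.eval (AddMonoidHom.snd ℂ ℂ) (deformedSum ζ w m) = 0 := by
  have : CharZero ℂ⟦X⟧ := charZero_of_injective_ringHom (f := (C : ℂ →+* ℂ⟦X⟧)) C_injective
  rw [eval_deformedSum]
  refine clearedSum_eq_zero_of_isDomain (by simp) ?_ (fun j => ?_) ?_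
  · simp [expMul_zero, ← map_pow, hζ]
  · simp [← expMul_add, expMul_zero]
  · simp only [AddMonoidHom.coe_snd, prod_expMul, sum_rootExponent hw, expMul_zero]

/-- Multiplication by w fixes the exponent 0 and permutes the other five cyclically, so symmetry
under this one cycle is enough. -/
theorem clearedSum_cycle {A : Type*} [CommRing A] (q : A) {x y x' y' : Fin 6 → A} (m : ℕ)
    (h0 : x' 0 = x 0 ∧ y' 0 = y 0) (h1 : x' 1 = x 2 ∧ y' 1 = y 2) (h2 : x' 2 = x 3 ∧ y' 2 = y 3)
    (h3 : x' 3 = x 4 ∧ y' 3 = y 4) (h4 : x' 4 = x 5 ∧ y' 4 = y 5) (h5 : x' 5 = x 1 ∧ y' 5 = y 1) :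
    clearedSum q x' y' m = clearedSum q x y m := by
  simp only [clearedSum, Fin.prod_univ_six, h0, h1, h2, h3, h4, h5]
  refine sum_congr rfl fun k _ => ?_
  ring

theorem rotate_deformedSum {ζ w : ℂ} {m : ℕ} (hw : w ^ 5 = 1) :
    ExpSum.rotate w (deformedSum ζ w m) = deformedSum ζ w m := by
  rw [deformedSum, map_clearedSum]
  simp only [ExpSum.rotate_single, mul_neg, mul_zero]
  have h0 : w * rootExponent w 0 = rootExponent w 0 := by simp [rootExponent]
  have h1 : w * rootExponent w 1 = rootExponent w 2 := by simp [rootExponent]; ring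
  have h2 : w * rootExponent w 2 = rootExponent w 3 := by simp [rootExponent]; ring
  have h3 : w * rootExponent w 3 = rootExponent w 4 := by simp [rootExponent]; ring
  have h4 : w * rootExponent w 4 = rootExponent w 5 := by simp [rootExponent, ← hw]; ring
  have h5 : w * rootExponent w 5 = rootExponent w 1 := by simp [rootExponent]
  refine clearedSum_cycle _ m ?_ ?_ ?_ ?_ ?_ ?_ <;> simp only [h0, h1, h2, h3, h4, h5, and_self]

/-- Otherwise w^4 would be real of modulus 1, forcing w^8 = 1. This keeps a denominator in Jackson's
sum nonzero. -/
theorem fifth_root_sum_ne_ofReal {w : ℂ} (hw : IsPrimitiveRoot w 5)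
    (hw0 : 1 + w + w ^ 2 + w ^ 3 + w ^ 4 = 0) (r : ℝ) : w + w ^ 2 + w ^ 3 ≠ r := by
  intro h
  have h1 : w ^ 4 = ((-1 - r : ℝ) : ℂ) := by push_cast; linear_combination hw0 - h
  have h2 := congrArg norm h1
  rw [norm_pow, Complex.norm_eq_one_of_pow_eq_one hw.pow_eq_one (by norm_num), one_pow,
    Complex.norm_real, Real.norm_eq_abs] at h2
  have h3 : (-1 - r) ^ 2 = 1 := by rw [← sq_abs, ← h2, one_pow]
  have h4 : w ^ 8 = 1 := by
    rw [show w ^ 8 = (w ^ 4) ^ 2 by ring, h1]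
    exact_mod_cast h3
  exact absurd ((hw.pow_eq_one_iff_dvd 8).mp h4) (by norm_num)

theorem one_sub_C_mul_expMul_ne_zero (z : ℂ) {a : ℂ} (ha : a ≠ 0) :
    1 - C z * expMul a ≠ 0 := by
  intro h
  have h0 := congrArg (coeff 0) h
  have h1 := congrArg (coeff 1) h
  rw [map_sub, coeff_C_mul, coeff_expMul, coeff_one] at h0 h1
  simp at h0 h1
  rcases h1 with h1 | h1
  · simp [h1] at h0
  · exact ha h1

theorem not_dvd_three_mul {t i : ℕ} (h0 : 0 < i) (hi : i ≤ 2 * t + 1) :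
    ¬ (3 * t + 2) ∣ 3 * i := by
  intro h
  have hc : Nat.Coprime (3 * t + 2) 3 := by
    rw [Nat.coprime_comm, Nat.coprime_mul_left_add_right]; norm_num
  exact absurd (Nat.le_of_dvd h0 (hc.dvd_of_dvd_mul_left h)) (by omega)

theorem X_pow_six_dvd {ζ : ℂ} {t : ℕ} (hζ : IsPrimitiveRoot ζ (3 * t + 2)) {q : ℂ⟦X⟧}
    (hq : q = C ζ * expMul 1) :
    X ^ 6 ∣ clearedSum q (fun _ : Fin 6 => 1) (fun _ => 1) (2 * t + 1) -
      5 * (1 - q ^ (2 * (3 * t + 2))) * (∏ i ∈ range (2 * t + 1), (1 - q ^ (3 * i + 2))) ^ 3 *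
        (∏ i ∈ range (2 * t + 1), (1 - q ^ (3 * i + 3))) ^ 3 := by
  obtain ⟨w, hw⟩ : ∃ w : ℂ, IsPrimitiveRoot w 5 :=
    ⟨_, Complex.isPrimitiveRoot_exp 5 (by norm_num)⟩
  have hw5 := hw.pow_eq_one
  have hw0 : 1 + w + w ^ 2 + w ^ 3 + w ^ 4 = 0 := by
    have := hw.geom_sum_eq_zero (by norm_num)
    simpa [sum_range_succ] using this
  obtain ⟨n, hn⟩ : ∃ n, n = 3 * t + 2 := ⟨_, rfl⟩
  obtain ⟨m, hm⟩ : ∃ m, m = 2 * t + 1 := ⟨_, rfl⟩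
  have hmn : 3 * m + 1 = 2 * n := by omega
  have hζm : ζ ^ (3 * m + 1) = 1 := by
    rw [hmn, hn, mul_comm, pow_mul, hζ.pow_eq_one, one_pow]
  have hqk (k : ℕ) : q ^ k = C (ζ ^ k) * expMul k := by
    rw [hq, mul_pow, expMul_pow, map_pow, mul_one]
  -- This value makes x_5 = exp(-2n s), the inverse of q^(3m+1) = q^(2n), so the series terminates.
  obtain ⟨c, hc⟩ : ∃ c : ℂ, c = -(2 * (n : ℂ)) := ⟨_, rfl⟩
  have key := ExpSum.X_pow_dvd_eval_sub hw (eval_snd_deformedSum hζm hw0)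
    (rotate_deformedSum hw5) c
  have hl (d : ℂ) : alongLine d (1, 0) = 1 := by simp [alongLine]
  have hl' (d a : ℂ) : alongLine d (0, a) = a * d := by simp [alongLine]
  simp only [eval_deformedSum, hl, hl', mul_zero, expMul_zero, ← hq] at key
  obtain ⟨x, hx⟩ : ∃ x : Fin 6 → ℂ⟦X⟧, x = fun j => expMul (rootExponent w j * c) := ⟨_, rfl⟩
  obtain ⟨y, hy⟩ : ∃ y : Fin 6 → ℂ⟦X⟧, y = fun j => expMul (-rootExponent w j * c) := ⟨_, rfl⟩
  rw [← hx, ← hy] at key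
  have hyj (j : Fin 6) : y j = expMul (-rootExponent w j * c) := by rw [hy]
  have hxj (j : Fin 6) : x j = expMul (rootExponent w j * c) := by rw [hx]
  have hfac (k : ℕ) (a : ℂ) : 1 - q ^ k * expMul a = 1 - C (ζ ^ k) * expMul (k + a) := by
    rw [hqk, expMul_add, mul_assoc]
  have hζne (i : ℕ) (hi : i < m) : ζ ^ (3 * i + 3) ≠ 1 := by
    rw [Ne, hζ.pow_eq_one_iff_dvd, show 3 * i + 3 = 3 * (i + 1) by ring]
    exact not_dvd_three_mul (by omega) (by omega)
  have hq1 (i : ℕ) : 1 - q ^ (i + 1) ≠ 0 := by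
    rw [hqk]
    exact one_sub_C_mul_expMul_ne_zero _ (by exact_mod_cast i.succ_ne_zero)
  have hJ := clearedSum_mul_eq (q := q) x y m
    (by
      intro h
      have := congrArg (coeff 0) h
      rw [hq, coeff_C_mul, coeff_expMul] at this
      simp at this
      exact hζ.ne_zero (by omega) this)
    (fun j => by rw [hxj, hyj, ← expMul_add, neg_mul, add_neg_cancel, expMul_zero])
    (by rw [hxj]; simp [rootExponent, expMul_zero])
    (by
      simp only [hxj, ← expMul_add, ← expMul_zero]
      congr 1
      simp only [rootExponent, Matrix.cons_val]
      linear_combination c * hw0)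
    (by
      rw [hxj, hqk, hζm, map_one, one_mul, ← expMul_add, ← expMul_zero, hmn, hc]
      congr 1
      simp [rootExponent])
    (fun i hi j h => by
      rw [hyj, hfac] at h
      have := congrArg (coeff 0) h
      rw [map_sub, coeff_C_mul, coeff_expMul] at this
      simp [sub_eq_zero] at this
      exact hζne i hi this.symm)
    hq1
    -- Equality of the constant and linear coefficients would make w + w^2 + w^3 the real number (2
    -- - 3i)/(2n).
    (fun i h => by
      rw [hqk, hqk, hxj, hxj, hxj, ← expMul_add, ← expMul_add, mul_assoc, ← expMul_add] at h
      have h0 := congrArg (coeff 0) h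
      have h1 := congrArg (coeff 1) h
      rw [map_sub, coeff_C_mul, coeff_C_mul, coeff_expMul, coeff_expMul] at h0 h1
      simp [rootExponent, sub_eq_zero] at h0 h1
      rw [h0] at h1
      have h2 := mul_left_cancel₀ (pow_ne_zero 2 (hζ.ne_zero (by omega))) h1
      refine fifth_root_sum_ne_ofReal hw hw0 ((2 - 3 * i) / (2 * n)) ?_
      have hn0 : (n : ℂ) ≠ 0 := by exact_mod_cast (by omega : n ≠ 0)
      push_cast
      rw [hc] at h2
      field_simp
      linear_combination h2)
  have hy4 : y 4 = expMul (2 * (n : ℂ) * w ^ 4) := by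
    rw [hyj, hc]; congr 1; simp [rootExponent]; ring
  have hy5 : y 5 = expMul (2 * (n : ℂ)) := by rw [hyj, hc]; congr 1; simp [rootExponent]
  have hy12 : y 1 * y 2 = expMul (2 * (n : ℂ) * (w + w ^ 2)) := by
    rw [hyj, hyj, hc, ← expMul_add]; congr 1; simp [rootExponent]; ring
  have hy13 : y 1 * y 3 = expMul (2 * (n : ℂ) * (w + w ^ 3)) := by
    rw [hyj, hyj, hc, ← expMul_add]; congr 1; simp [rootExponent]; ring
  have hy23 : y 2 * y 3 = expMul (2 * (n : ℂ) * (w ^ 2 + w ^ 3)) := by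
    rw [hyj, hyj, hc, ← expMul_add]; congr 1; simp [rootExponent]; ring
  have hy123 : y 1 * y 2 * y 3 = expMul (2 * (n : ℂ) * (w + w ^ 2 + w ^ 3)) := by
    rw [hy12, hyj, hc, ← expMul_add]; congr 1; simp [rootExponent]; ring
  have hs (r : ℕ) (δ : ℂ) :
      ∏ i ∈ range m, (1 - q ^ (3 * i + r) * expMul δ) = shiftedExp ζ r m δ := by
    simp only [shiftedExp, hfac]
  have hs0 (r : ℕ) : ∏ i ∈ range m, (1 - q ^ (3 * i + r)) = shiftedExp ζ r m 0 := by
    simp only [← hs, expMul_zero, mul_one]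
  -- The denominator of Jackson's evaluation is a unit: n divides no 3i + 1 with i < m, since 0 < 3i
  -- + 1 < 2n and n ≡ 2 mod 3.
  have hU : IsUnit (shiftedExp ζ 1 m (2 * (n : ℂ) * (w + w ^ 2 + w ^ 3))) := by
    rw [isUnit_iff_constantCoeff, isUnit_iff_ne_zero, shiftedExp, map_prod, prod_ne_zero_iff]
    intro i hi h
    rw [← coeff_zero_eq_constantCoeff_apply, map_sub, coeff_C_mul, coeff_expMul] at h
    simp [sub_eq_zero] at h
    have h1 := (hζ.pow_eq_one_iff_dvd _).mp h.symm
    have h2 := mem_range.mp hi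
    obtain ⟨j, hj⟩ := h1
    have : j < 2 := by by_contra hj'; nlinarith
    interval_cases j <;> omega
  simp only [hy123] at hJ
  simp only [prod_mul_distrib, hy12, hy13, hy23, hy4, hy5, hs, hs0, hmn] at hJ
  rw [← hm, ← hn, hs0, hs0]
  obtain ⟨h, hh, -⟩ := exists_hasJet_one_sub_expMul (2 * n : ℕ)
  have hX : 1 - q ^ (2 * n) = X * h := by
    rw [← hh, hqk, mul_comm 2 n, pow_mul, hn, hζ.pow_eq_one, one_pow, map_one, one_mul]
  obtain ⟨k, hk⟩ := X_pow_dvd_shiftedExp_sub hζ hw0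
  rw [← hm, ← hn] at hk
  have hdvd : X ^ 6 ∣ clearedSum q x y m -
      5 * (1 - q ^ (2 * n)) * shiftedExp ζ 2 m 0 ^ 3 * shiftedExp ζ 3 m 0 ^ 3 := by
    rw [← hU.dvd_mul_right]
    -- The sixth power of X is one from 1 - q^(2n) and five from the comparison of products.
    refine ⟨h * shiftedExp ζ 3 m 0 * k, ?_⟩
    rw [hX] at hJ ⊢
    linear_combination hJ + X * h * shiftedExp ζ 3 m 0 * hk
  have := dvd_sub hdvd key
  rwa [sub_sub_sub_cancel_left] at this

end LocalExpansion

/-! ### From power series and values at ζ to divisibility by cyclotomic polynomials -/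

section LocalDivisibility

open Polynomial

theorem minpoly_dvd_of_aeval_eq_zero {ζ : ℂ} {d : ℕ} (hd : 0 < d) (hζ : IsPrimitiveRoot ζ d)
    {P : ℚ[X]} (h : aeval ζ P = 0) : cyclotomic d ℚ ∣ P := by
  rw [cyclotomic_eq_minpoly_rat hζ hd]
  exact minpoly.dvd ℚ ζ h

theorem aeval_cyclotomic_eq_zero {ζ : ℂ} {d : ℕ} (hd : 0 < d) (hζ : IsPrimitiveRoot ζ d) :
    aeval ζ (cyclotomic d ℚ) = 0 := by
  rw [cyclotomic_eq_minpoly_rat hζ hd, minpoly.aeval]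

/-- The expansion of polynomials at `ζ` in the local parameter `s`, where `X = ζ exp s`. -/
noncomputable def expansion (ζ : ℂ) : ℚ[X] →+* PowerSeries ℂ :=
  eval₂RingHom ((PowerSeries.C).comp (algebraMap ℚ ℂ)) (PowerSeries.C ζ * expMul 1)

theorem expansion_X (ζ : ℂ) : expansion ζ X = PowerSeries.C ζ * expMul 1 := by
  simp [expansion]

theorem constantCoeff_expansion (ζ : ℂ) (P : ℚ[X]) :
    PowerSeries.constantCoeff (expansion ζ P) = aeval ζ P := by
  have h1 : PowerSeries.constantCoeff (expMul 1) = 1 := by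
    rw [← PowerSeries.coeff_zero_eq_constantCoeff_apply, coeff_expMul]; simp
  rw [expansion, coe_eval₂RingHom, hom_eval₂, map_mul, h1, mul_one, aeval_def]
  congr 1

theorem X_dvd_expansion_iff {ζ : ℂ} {P : ℚ[X]} :
    PowerSeries.X ∣ expansion ζ P ↔ aeval ζ P = 0 := by
  rw [PowerSeries.X_dvd_iff, constantCoeff_expansion]

/-- Φ_d divides X^d - 1, whose expansion exp(d s) - 1 has a simple zero. -/
theorem not_X_sq_dvd_expansion_cyclotomic {ζ : ℂ} {d : ℕ} (hd : 0 < d)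
    (hζ : IsPrimitiveRoot ζ d) :
    ¬ PowerSeries.X ^ 2 ∣ expansion ζ (cyclotomic d ℚ) := by
  intro h
  have h1 := h.trans (map_dvd (expansion ζ) (cyclotomic.dvd_X_pow_sub_one d ℚ))
  rw [map_sub, map_pow, expansion_X, map_one, mul_pow, expMul_pow, ← map_pow, hζ.pow_eq_one,
    map_one, one_mul, mul_one, PowerSeries.X_pow_dvd_iff] at h1
  have h2 := h1 1 (by norm_num)
  rw [map_sub, coeff_expMul, PowerSeries.coeff_one] at h2
  simp at h2
  omega

/-- One factor Φ_d is removed at a time: vanishing at ζ gives divisibility by the minimal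
polynomial, and the simple zero of Φ_d costs exactly one power of s. -/
theorem cyclotomic_pow_dvd_of_X_pow_dvd {ζ : ℂ} {d : ℕ} (hd : 0 < d) (hζ : IsPrimitiveRoot ζ d)
    {e : ℕ} {P : ℚ[X]} (h : PowerSeries.X ^ e ∣ expansion ζ P) : cyclotomic d ℚ ^ e ∣ P := by
  induction e generalizing P with
  | zero => simp
  | succ e ih =>
    obtain ⟨P, rfl⟩ := minpoly_dvd_of_aeval_eq_zero hd hζ
      (X_dvd_expansion_iff.mp ((dvd_pow_self _ e.succ_ne_zero).trans h))
    obtain ⟨g, hg⟩ := X_dvd_expansion_iff.mpr (aeval_cyclotomic_eq_zero hd hζ)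
    have hg' : ¬ PowerSeries.X ∣ g := fun ⟨g', hg'⟩ =>
      not_X_sq_dvd_expansion_cyclotomic hd hζ ⟨g', by rw [hg, hg']; ring⟩
    rw [map_mul, hg, pow_succ', mul_assoc, mul_dvd_mul_iff_left PowerSeries.X_ne_zero] at h
    rw [pow_succ']
    exact mul_dvd_mul_left _ (ih (PowerSeries.X_prime.pow_dvd_of_dvd_mul_left e hg' h))

/-- `f` is a quotient of a polynomial divisible by `p ^ e` and a polynomial not divisible
by `p`. -/
def LocDvd (p : ℚ[X]) (e : ℕ) (f : RatFunc ℚ) : Prop :=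
  ∃ N D : ℚ[X], ¬ p ∣ D ∧ p ^ e ∣ N ∧
    f * algebraMap ℚ[X] (RatFunc ℚ) D = algebraMap ℚ[X] (RatFunc ℚ) N

theorem LocDvd.pow_dvd_num {p : ℚ[X]} (hp : Irreducible p) {e : ℕ} {f : RatFunc ℚ}
    (h : LocDvd p e f) : p ^ e ∣ f.num := by
  obtain ⟨N, D, hD, hN, hf⟩ := h
  have h1 : f.num * D = N * f.denom := by
    apply RatFunc.algebraMap_injective ℚ
    have hd : algebraMap ℚ[X] (RatFunc ℚ) f.denom ≠ 0 :=
      (map_ne_zero_iff _ (RatFunc.algebraMap_injective ℚ)).mpr f.denom_ne_zero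
    have h2 := RatFunc.num_div_denom f
    rw [div_eq_iff hd] at h2
    rw [map_mul, map_mul, ← hf, h2]
    ring
  exact ((hp.coprime_iff_not_dvd.mpr hD).pow_left).dvd_of_dvd_mul_right
    (h1 ▸ Dvd.dvd.mul_right hN _)

theorem LocDvd.add {p : ℚ[X]} (hp : Irreducible p) {e : ℕ} {f g : RatFunc ℚ}
    (hf : LocDvd p e f) (hg : LocDvd p e g) : LocDvd p e (f + g) := by
  obtain ⟨N, D, hD, hN, h⟩ := hf
  obtain ⟨N', D', hD', hN', h'⟩ := hg
  refine ⟨N * D' + N' * D, D * D', fun hd => (hp.prime.dvd_or_dvd hd).elim hD hD',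
    dvd_add (hN.mul_right _) (hN'.mul_right _), ?_⟩
  simp only [map_mul, map_add]
  linear_combination algebraMap ℚ[X] (RatFunc ℚ) D' * h + algebraMap ℚ[X] (RatFunc ℚ) D * h'

theorem LocDvd.mul {p : ℚ[X]} (hp : Irreducible p) {e e' : ℕ} {f g : RatFunc ℚ}
    (hf : LocDvd p e f) (hg : LocDvd p e' g) : LocDvd p (e + e') (f * g) := by
  obtain ⟨N, D, hD, hN, h⟩ := hf
  obtain ⟨N', D', hD', hN', h'⟩ := hg
  refine ⟨N * N', D * D', fun hd => (hp.prime.dvd_or_dvd hd).elim hD hD',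
    pow_add p e e' ▸ mul_dvd_mul hN hN', ?_⟩
  simp only [map_mul, ← h, ← h']
  ring

theorem LocDvd.zero {p : ℚ[X]} (hp : Irreducible p) (e : ℕ) : LocDvd p e 0 :=
  ⟨0, 1, hp.prime.not_dvd_one, dvd_zero _, by simp⟩

theorem LocDvd.sum {p : ℚ[X]} (hp : Irreducible p) {e : ℕ} {ι : Type*} (s : Finset ι)
    {f : ι → RatFunc ℚ} (h : ∀ i ∈ s, LocDvd p e (f i)) : LocDvd p e (∑ i ∈ s, f i) := by
  classical
  induction s using Finset.induction_on with
  | empty => simpa using LocDvd.zero hp e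
  | insert a s ha ih =>
    rw [sum_insert ha]
    exact (h a (mem_insert_self a s)).add hp (ih fun i hi => h i (mem_insert_of_mem hi))

theorem LocDvd.pow {p : ℚ[X]} (hp : Irreducible p) {e : ℕ} {f : RatFunc ℚ} (h : LocDvd p e f)
    (k : ℕ) : LocDvd p (e * k) (f ^ k) := by
  induction k with
  | zero => exact ⟨1, 1, hp.prime.not_dvd_one, by simp, by simp⟩
  | succ k ih => rw [pow_succ]; exact ih.mul hp h

/-- The rational function `f` is regular at `ζ`, with value `v`. -/
def HasValue (ζ : ℂ) (f : RatFunc ℚ) (v : ℂ) : Prop :=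
  ∃ N D : ℚ[X], aeval ζ D ≠ 0 ∧
    f * algebraMap ℚ[X] (RatFunc ℚ) D = algebraMap ℚ[X] (RatFunc ℚ) N ∧ v * aeval ζ D = aeval ζ N

section HasValue

variable {ζ : ℂ} {f g : RatFunc ℚ} {v v' : ℂ}

theorem HasValue.locDvd_zero {d : ℕ} (hd : 0 < d) (hζ : IsPrimitiveRoot ζ d)
    (h : HasValue ζ f v) : LocDvd (cyclotomic d ℚ) 0 f := by
  obtain ⟨N, D, hD, hf, -⟩ := h
  refine ⟨N, D, fun ⟨D', hD'⟩ => hD ?_, by simp, hf⟩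
  rw [hD', map_mul, aeval_cyclotomic_eq_zero hd hζ, zero_mul]

theorem HasValue.locDvd_one {d : ℕ} (hd : 0 < d) (hζ : IsPrimitiveRoot ζ d)
    (h : HasValue ζ f 0) : LocDvd (cyclotomic d ℚ) 1 f := by
  obtain ⟨N, D, hD, hf, hv⟩ := h
  refine ⟨N, D, fun ⟨D', hD'⟩ => hD ?_, ?_, hf⟩
  · rw [hD', map_mul, aeval_cyclotomic_eq_zero hd hζ, zero_mul]
  · rw [pow_one]
    exact minpoly_dvd_of_aeval_eq_zero hd hζ (by rw [← hv, zero_mul])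

theorem HasValue.add (hf : HasValue ζ f v) (hg : HasValue ζ g v') :
    HasValue ζ (f + g) (v + v') := by
  obtain ⟨N, D, hD, h, e⟩ := hf
  obtain ⟨N', D', hD', h', e'⟩ := hg
  refine ⟨N * D' + N' * D, D * D', by rw [map_mul]; exact mul_ne_zero hD hD', ?_, ?_⟩
  · simp only [map_mul, map_add]
    linear_combination algebraMap ℚ[X] (RatFunc ℚ) D' * h + algebraMap ℚ[X] (RatFunc ℚ) D * h'
  · simp only [map_mul, map_add]
    linear_combination aeval ζ D' * e + aeval ζ D * e'

theorem HasValue.mul (hf : HasValue ζ f v) (hg : HasValue ζ g v') :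
    HasValue ζ (f * g) (v * v') := by
  obtain ⟨N, D, hD, h, e⟩ := hf
  obtain ⟨N', D', hD', h', e'⟩ := hg
  refine ⟨N * N', D * D', by rw [map_mul]; exact mul_ne_zero hD hD', ?_, ?_⟩
  · simp only [map_mul, ← h, ← h']
    ring
  · simp only [map_mul, ← e, ← e']
    ring

theorem HasValue.of_polynomial (ζ : ℂ) (P : ℚ[X]) :
    HasValue ζ (algebraMap ℚ[X] (RatFunc ℚ) P) (aeval ζ P) :=
  ⟨P, 1, by simp, by simp, by simp⟩

theorem HasValue.one : HasValue ζ 1 1 := by simpa using HasValue.of_polynomial ζ 1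

theorem HasValue.inv (hf : HasValue ζ f v) (hv : v ≠ 0) : HasValue ζ f⁻¹ v⁻¹ := by
  obtain ⟨N, D, hD, h, e⟩ := hf
  have hN : aeval ζ N ≠ 0 := e ▸ mul_ne_zero hv hD
  have hf0 : f ≠ 0 := by
    rintro rfl
    rw [zero_mul, eq_comm, map_eq_zero_iff _ (RatFunc.algebraMap_injective ℚ)] at h
    rw [h, map_zero] at hN
    exact hN rfl
  refine ⟨D, N, hN, ?_, ?_⟩
  · rw [← h, inv_mul_cancel_left₀ hf0]
  · rw [← e, inv_mul_cancel_left₀ hv]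

theorem HasValue.div (hf : HasValue ζ f v) (hg : HasValue ζ g v') (hv : v' ≠ 0) :
    HasValue ζ (f / g) (v / v') := by
  rw [div_eq_mul_inv, div_eq_mul_inv]
  exact hf.mul (hg.inv hv)

theorem HasValue.prod {ι : Type*} (s : Finset ι) {f : ι → RatFunc ℚ} {v : ι → ℂ}
    (h : ∀ i ∈ s, HasValue ζ (f i) (v i)) : HasValue ζ (∏ i ∈ s, f i) (∏ i ∈ s, v i) := by
  classical
  induction s using Finset.induction_on with
  | empty => simpa using HasValue.one
  | insert a s ha ih =>
    rw [prod_insert ha, prod_insert ha]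
    exact (h a (mem_insert_self a s)).mul (ih fun i hi => h i (mem_insert_of_mem hi))

theorem HasValue.sum {ι : Type*} (s : Finset ι) {f : ι → RatFunc ℚ} {v : ι → ℂ}
    (h : ∀ i ∈ s, HasValue ζ (f i) (v i)) : HasValue ζ (∑ i ∈ s, f i) (∑ i ∈ s, v i) := by
  classical
  induction s using Finset.induction_on with
  | empty => simpa using HasValue.of_polynomial ζ 0
  | insert a s ha ih =>
    rw [sum_insert ha, sum_insert ha]
    exact (h a (mem_insert_self a s)).add (ih fun i hi => h i (mem_insert_of_mem hi))

theorem HasValue.pow (h : HasValue ζ f v) (k : ℕ) : HasValue ζ (f ^ k) (v ^ k) := by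
  induction k with
  | zero => simpa using HasValue.one
  | succ k ih => rw [pow_succ, pow_succ]; exact ih.mul h

theorem HasValue.X_pow (ζ : ℂ) (k : ℕ) : HasValue ζ (RatFunc.X ^ k) (ζ ^ k) := by
  simpa using HasValue.of_polynomial ζ (X ^ k)

theorem HasValue.one_sub_X_pow (ζ : ℂ) (k : ℕ) :
    HasValue ζ (1 - RatFunc.X ^ k) (1 - ζ ^ k) := by
  have h := HasValue.of_polynomial ζ (1 - X ^ k)
  rw [map_sub, map_sub] at h
  simpa using h

end HasValue

end LocalDivisibility

/-! ### Block structure of the series at a primitive d-th root of unity -/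

section ShiftedQuotients

/-- The quotient `(q ^ c; q ^ 3)_k / (q ^ 3; q ^ 3)_k`. -/
noncomputable def shiftedQuotient {F : Type*} [Field F] (q : F) (c k : ℕ) : F :=
  ∏ i ∈ range k, (1 - q ^ (3 * i + c)) / (1 - q ^ (3 * i + 3))

theorem qShifted_cube {F : Type*} [Field F] (q : F) (c k : ℕ) :
    qShifted (q ^ c) (q ^ 3) k = ∏ i ∈ range k, (1 - q ^ (3 * i + c)) := by
  simp only [qShifted, ← pow_mul, ← pow_add, add_comm c]

theorem qShifted_div {F : Type*} [Field F] (q : F) (c k : ℕ) :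
    qShifted (q ^ c) (q ^ 3) k / qShifted (q ^ 3) (q ^ 3) k = shiftedQuotient q c k := by
  rw [qShifted_cube, qShifted_cube, shiftedQuotient, prod_div_distrib]

theorem X_pow_ne_one {d : ℕ} (hd : 0 < d) : (RatFunc.X : RatFunc ℚ) ^ d ≠ 1 := by
  intro h
  have h1 : algebraMap (Polynomial ℚ) (RatFunc ℚ) (Polynomial.X ^ d - 1) = 0 := by simp [h]
  rw [map_eq_zero_iff _ (RatFunc.algebraMap_injective ℚ)] at h1
  exact Polynomial.X_pow_sub_C_ne_zero hd (1 : ℚ) (by simpa using h1)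

theorem hasValue_div_of_dvd {ζ : ℂ} {d : ℕ} (hd : 0 < d) (hζ : ζ ^ d = 1) (a : ℕ) {b : ℕ}
    (hb : 0 < b) :
    HasValue ζ ((1 - RatFunc.X ^ (d * a)) / (1 - RatFunc.X ^ (d * b))) (a / b) := by
  have hg (a : ℕ) : HasValue ζ (∑ i ∈ range a, RatFunc.X ^ (d * i)) a := by
    have := HasValue.sum (range a) fun i _ => HasValue.X_pow ζ (d * i)
    simpa [pow_mul, hζ] using this
  have hne : (1 : RatFunc ℚ) - RatFunc.X ^ d ≠ 0 := sub_ne_zero.mpr (X_pow_ne_one hd).symm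
  have h := (hg a).div (hg b) (by exact_mod_cast hb.ne')
  simp only [pow_mul] at h ⊢
  rwa [← mul_neg_geom_sum (RatFunc.X ^ d) a, ← mul_neg_geom_sum (RatFunc.X ^ d) b, mul_div_mul_left _ _ hne]

variable {ζ : ℂ} {d : ℕ}

theorem pow_ne_one_of_lt (hζ : IsPrimitiveRoot ζ d) (hd3 : Nat.Coprime d 3) {i : ℕ} (j : ℕ)
    (hi : i + 1 < d) : ζ ^ (3 * (d * j + i) + 3) ≠ 1 := by
  rw [Ne, hζ.pow_eq_one_iff_dvd, show 3 * (d * j + i) + 3 = 3 * (i + 1) + d * (3 * j) by ring,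
    Nat.dvd_add_left (Nat.dvd_mul_right d _)]
  intro h
  exact absurd (Nat.le_of_dvd (by omega) (hd3.dvd_of_dvd_mul_left h)) (by omega)

/-- The only denominator factor vanishing at ζ is i = d - 1; it is paired with the numerator factor
i = i₀, which also vanishes, and their ratio is regular. -/
theorem hasValue_block (hζ : IsPrimitiveRoot ζ d) (hd3 : Nat.Coprime d 3) {c i₀ : ℕ}
    (hi₀ : i₀ < d) (hc : d ∣ 3 * i₀ + c) (j : ℕ) :
    ∃ v, HasValue ζ (∏ i ∈ range d, (1 - RatFunc.X ^ (3 * (d * j + i) + c)) /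
      (1 - RatFunc.X ^ (3 * (d * j + i) + 3))) v := by
  obtain ⟨e, he⟩ := hc
  have hd : 0 < d := by omega
  rw [prod_div_distrib, ← mul_prod_erase _ _ (mem_range.mpr hi₀),
    ← mul_prod_erase (range d) (fun i => 1 - RatFunc.X ^ (3 * (d * j + i) + 3))
      (show d - 1 ∈ range d by simp; omega), mul_div_mul_comm,
    show 3 * (d * j + i₀) + c = d * (3 * j + e) by linear_combination he,
    show 3 * (d * j + (d - 1)) + 3 = d * (3 * j + 3) by
      obtain ⟨d, rfl⟩ : ∃ d', d = d' + 1 := ⟨d - 1, by omega⟩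
      rw [Nat.add_sub_cancel]; ring]
  refine ⟨_, (hasValue_div_of_dvd hd hζ.pow_eq_one _ (by omega)).mul
    ((HasValue.prod _ fun i _ => HasValue.one_sub_X_pow ζ _).div
      (HasValue.prod _ fun i _ => HasValue.one_sub_X_pow ζ _) (prod_ne_zero_iff.mpr ?_))⟩
  intro i hi
  simp only [mem_erase, mem_range] at hi
  exact sub_ne_zero.mpr (pow_ne_one_of_lt hζ hd3 j (by omega)).symm

theorem exists_hasValue_shiftedQuotient_mul (hζ : IsPrimitiveRoot ζ d) (hd3 : Nat.Coprime d 3)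
    {c i₀ : ℕ} (hi₀ : i₀ < d) (hc : d ∣ 3 * i₀ + c) (j : ℕ) :
    ∃ v, HasValue ζ (shiftedQuotient RatFunc.X c (d * j)) v := by
  induction j with
  | zero => exact ⟨1, by simpa [shiftedQuotient] using HasValue.one⟩
  | succ j ih =>
    obtain ⟨v, hv⟩ := ih
    obtain ⟨v', hv'⟩ := hasValue_block hζ hd3 hi₀ hc j
    refine ⟨v * v', ?_⟩
    rw [shiftedQuotient, mul_add_one, prod_range_add]
    exact hv.mul hv'

theorem hasValue_shiftedQuotient_add (hζ : IsPrimitiveRoot ζ d) (hd3 : Nat.Coprime d 3) {c : ℕ}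
    {j l : ℕ} (hl : l < d) {v : ℂ} (hv : HasValue ζ (shiftedQuotient RatFunc.X c (d * j)) v) :
    HasValue ζ (shiftedQuotient RatFunc.X c (d * j + l)) (v * shiftedQuotient ζ c l) := by
  rw [shiftedQuotient, prod_range_add]
  refine hv.mul (HasValue.prod _ fun i hi => ?_)
  have hi := mem_range.mp hi
  have h := (HasValue.one_sub_X_pow ζ (3 * (d * j + i) + c)).div
    (HasValue.one_sub_X_pow ζ (3 * (d * j + i) + 3))
    (sub_ne_zero.mpr (pow_ne_one_of_lt hζ hd3 j (by omega)).symm)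
  have e (c : ℕ) : ζ ^ (3 * (d * j + i) + c) = ζ ^ (3 * i + c) := by
    rw [show 3 * (d * j + i) + c = d * (3 * j) + (3 * i + c) by ring, pow_add, pow_mul,
      hζ.pow_eq_one, one_pow, one_mul]
  rwa [e, e] at h

/-- The `k`-th term of the truncated series. -/
noncomputable def seriesTerm {F : Type*} [Field F] (q : F) (k : ℕ) : F :=
  qInteger q (6 * k + 1) * shiftedQuotient q 1 k ^ 6 * q ^ (3 * k)

theorem hasValue_qInteger (hζ : ζ ≠ 1) (r : ℕ) :
    HasValue ζ (qInteger RatFunc.X r) (qInteger ζ r) :=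
  (HasValue.one_sub_X_pow ζ r).div (by simpa using HasValue.one_sub_X_pow ζ 1)
    (sub_ne_zero.mpr hζ.symm)

/-- At ζ everything but the quotient over the completed blocks is periodic in k, so each block is a
scalar multiple of the first. -/
theorem hasValue_seriesTerm (hζ : IsPrimitiveRoot ζ d) (hd : 1 < d) (hd3 : Nat.Coprime d 3)
    {j l : ℕ} (hl : l < d) {v : ℂ} (hv : HasValue ζ (shiftedQuotient RatFunc.X 1 (d * j)) v) :
    HasValue ζ (seriesTerm RatFunc.X (d * j + l)) (v ^ 6 * seriesTerm ζ l) := by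
  have h := ((hasValue_qInteger (hζ.ne_one hd) (6 * (d * j + l) + 1)).mul
    ((hasValue_shiftedQuotient_add hζ hd3 hl hv).pow 6)).mul
    (HasValue.X_pow ζ (3 * (d * j + l)))
  convert! h using 1
  have e (a b : ℕ) : ζ ^ (d * a + b) = ζ ^ b := by
    rw [pow_add, pow_mul, hζ.pow_eq_one, one_pow, one_mul]
  rw [seriesTerm, qInteger, qInteger,
    show 6 * (d * j + l) + 1 = d * (6 * j) + (6 * l + 1) by ring,
    show 3 * (d * j + l) = d * (3 * j) + 3 * l by ring, e, e]
  ring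

theorem mul_sum_seriesTerm {F : Type*} [Field F] {q : F} (hq : q ≠ 1) {m : ℕ}
    (hne : ∀ i < m, 1 - q ^ (3 * i + 3) ≠ 0) :
    (1 - q) * (∏ i ∈ range m, (1 - q ^ (3 * i + 3))) ^ 6 * ∑ k ∈ range (m + 1), seriesTerm q k =
      clearedSum q (fun _ : Fin 6 => 1) (fun _ => 1) m := by
  rw [clearedSum, mul_sum]
  refine sum_congr rfl fun k hk => ?_
  have hk : k ≤ m := by have := mem_range.mp hk; omega
  simp only [mul_one, prod_const, card_univ, Fintype.card_fin]
  rw [seriesTerm, shiftedQuotient, qInteger, prod_div_distrib, ← prod_range_mul_prod_Ico _ hk]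
  have hk' : ∏ i ∈ range k, (1 - q ^ (3 * i + 3)) ≠ 0 :=
    prod_ne_zero_iff.mpr fun i hi => hne i (by have := mem_range.mp hi; omega)
  have : 1 - q ≠ 0 := sub_ne_zero.mpr hq.symm
  field_simp

theorem sum_seriesTerm_eq_zero (hζ : IsPrimitiveRoot ζ d) (hd : 1 < d) (hd3 : Nat.Coprime d 3)
    {l : ℕ} (hl : l < d) (h1 : ζ ^ (3 * l + 1) = 1) : ∑ k ∈ range (l + 1), seriesTerm ζ k = 0 := by
  have h := clearedSum_eq_zero (ι := Fin 6) (x := fun _ => 1) (by simp) h1 (by simp)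
  have hne (i : ℕ) (hi : i < l) : 1 - ζ ^ (3 * i + 3) ≠ 0 := by
    simpa using sub_ne_zero.mpr (pow_ne_one_of_lt hζ hd3 0 (show i + 1 < d by omega)).symm
  simp only [inv_one] at h
  rw [← mul_sum_seriesTerm (hζ.ne_one hd) hne] at h
  exact (mul_eq_zero.mp h).resolve_left (mul_ne_zero (sub_ne_zero.mpr (hζ.ne_one hd).symm)
    (pow_ne_zero _ (prod_ne_zero_iff.mpr fun i hi => hne i (mem_range.mp hi))))

/-- The numerator factor i = l is zero, whatever the denominators are. -/
theorem seriesTerm_eq_zero {F : Type*} [Field F] {q : F} {l k : ℕ} (h1 : q ^ (3 * l + 1) = 1)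
    (hk : l < k) : seriesTerm q k = 0 := by
  have : shiftedQuotient q 1 k = 0 := prod_eq_zero (mem_range.mpr hk) (by simp [h1])
  simp [seriesTerm, this]

theorem sum_block_seriesTerm_eq_zero (hζ : IsPrimitiveRoot ζ d) (hd : 1 < d) (hd3 : Nat.Coprime d 3)
    {l : ℕ} (hl : l < d) (h1 : ζ ^ (3 * l + 1) = 1) :
    ∑ k ∈ range d, seriesTerm ζ k = 0 := by
  rw [← sum_range_add_sum_Ico _ (show l + 1 ≤ d by omega), sum_seriesTerm_eq_zero hζ hd hd3 hl h1,
    zero_add]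
  exact sum_eq_zero fun k hk => seriesTerm_eq_zero h1 (by have := mem_Ico.mp hk; omega)

/-- A sum over complete blocks of length `d`, followed by an incomplete block on which the sum
at `ζ` vanishes, vanishes at `ζ`. -/
theorem hasValue_sum_seriesTerm (hζ : IsPrimitiveRoot ζ d) (hd : 1 < d) (hd3 : Nat.Coprime d 3)
    {l : ℕ} (hl : l < d) (h1 : d ∣ 3 * l + 1) (J : ℕ) {L : ℕ} (hL : L ≤ d)
    (hsum : ∑ k ∈ range L, seriesTerm ζ k = 0) :
    HasValue ζ (∑ k ∈ range (d * J + L), seriesTerm RatFunc.X k) 0 := by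
  have hblock (j L : ℕ) (hL : L ≤ d) (hsum : ∑ k ∈ range L, seriesTerm ζ k = 0) :
      HasValue ζ (∑ k ∈ range L, seriesTerm RatFunc.X (d * j + k)) 0 := by
    obtain ⟨v, hv⟩ := exists_hasValue_shiftedQuotient_mul hζ hd3 hl h1 j
    have h := HasValue.sum (range L) fun k hk =>
      hasValue_seriesTerm hζ hd hd3 (show k < d by have := mem_range.mp hk; omega) hv
    rwa [← mul_sum, hsum, mul_zero] at h
  rw [sum_range_add]
  refine add_zero (0 : ℂ) ▸ HasValue.add ?_ (hblock J L hL hsum)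
  induction J with
  | zero => simpa using HasValue.of_polynomial ζ 0
  | succ J ih =>
    rw [mul_add_one, sum_range_add]
    exact add_zero (0 : ℂ) ▸ ih.add (hblock J d le_rfl (sum_block_seriesTerm_eq_zero hζ hd hd3 hl
      ((hζ.pow_eq_one_iff_dvd _).mpr h1)))

end ShiftedQuotients

/-! ### Assembly of the local congruences -/

section Supercongruence

/-- The right-hand side of the congruence, for `n = 3 t + 2`. -/
noncomputable def closedForm {F : Type*} [Field F] (q : F) (t : ℕ) : F :=
  5 * qInteger q (2 * (3 * t + 2)) * shiftedQuotient q 2 (2 * t + 1) ^ 3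

theorem locDvd_six {t : ℕ} {ζ : ℂ} (hζ : IsPrimitiveRoot ζ (3 * t + 2)) :
    LocDvd (Polynomial.cyclotomic (3 * t + 2) ℚ) 6
      (∑ k ∈ range (2 * t + 1 + 1), seriesTerm RatFunc.X k - closedForm RatFunc.X t) := by
  refine ⟨clearedSum Polynomial.X (fun _ : Fin 6 => 1) (fun _ => 1) (2 * t + 1) -
      5 * (1 - Polynomial.X ^ (2 * (3 * t + 2))) *
        (∏ i ∈ range (2 * t + 1), (1 - Polynomial.X ^ (3 * i + 2))) ^ 3 *
        (∏ i ∈ range (2 * t + 1), (1 - Polynomial.X ^ (3 * i + 3))) ^ 3,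
    (1 - Polynomial.X) * (∏ i ∈ range (2 * t + 1), (1 - Polynomial.X ^ (3 * i + 3))) ^ 6,
    ?_, ?_, ?_⟩
  · rintro ⟨P, hP⟩
    have h := congrArg (Polynomial.aeval ζ) hP
    rw [map_mul _ (Polynomial.cyclotomic _ _), aeval_cyclotomic_eq_zero (by omega) hζ, zero_mul]
      at h
    simp only [map_mul, map_sub, map_pow, map_prod, map_one, Polynomial.aeval_X] at h
    refine mul_ne_zero (sub_ne_zero.mpr (hζ.ne_one (by omega)).symm) (pow_ne_zero _
      (prod_ne_zero_iff.mpr fun i hi => sub_ne_zero.mpr fun h' => ?_)) h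
    have h' := (hζ.pow_eq_one_iff_dvd _).mp h'.symm
    rw [show 3 * i + 3 = 3 * (i + 1) by ring] at h'
    exact not_dvd_three_mul (by omega) (by have := mem_range.mp hi; omega) h'
  · refine cyclotomic_pow_dvd_of_X_pow_dvd (by omega) hζ ?_
    have h := X_pow_six_dvd hζ (expansion_X ζ)
    simpa only [map_sub, map_mul, map_pow, map_prod, map_one, map_ofNat, map_clearedSum] using h
  · have hX (k : ℕ) : (1 : RatFunc ℚ) - RatFunc.X ^ (k + 1) ≠ 0 :=
      sub_ne_zero.mpr (X_pow_ne_one k.succ_pos).symm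
    have hX1 : (RatFunc.X : RatFunc ℚ) ≠ 1 := by simpa using X_pow_ne_one one_pos
    have h := mul_sum_seriesTerm hX1 (m := 2 * t + 1) fun i _ => hX (3 * i + 2)
    simp only [map_sub, map_mul, map_pow, map_prod, map_one, map_ofNat, map_clearedSum,
      RatFunc.algebraMap_X]
    rw [← h, sub_mul, mul_comm (∑ k ∈ _, _)]
    congr 1
    have hP : ∏ i ∈ range (2 * t + 1), ((1 : RatFunc ℚ) - RatFunc.X ^ (3 * i + 3)) ≠ 0 :=
      prod_ne_zero_iff.mpr fun i _ => hX (3 * i + 2)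
    have := sub_ne_zero.mpr hX1.symm
    rw [closedForm, shiftedQuotient, prod_div_distrib, qInteger]
    field_simp

/-- The numerator (q; q^3)_k contains 1 - q^(2n), at i = 2t + 1, while no denominator factor
vanishes at ζ because k < n; the sixth power gives Φ_n^6. -/
theorem locDvd_six_seriesTerm {t : ℕ} {ζ : ℂ} (hζ : IsPrimitiveRoot ζ (3 * t + 2)) {k : ℕ}
    (h1 : 2 * t + 1 < k) (h2 : k < 3 * t + 2) :
    LocDvd (Polynomial.cyclotomic (3 * t + 2) ℚ) 6 (seriesTerm RatFunc.X k) := by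
  have hirr := Polynomial.cyclotomic.irreducible_rat (show 0 < 3 * t + 2 by omega)
  have hc : Nat.Coprime (3 * t + 2) 3 := by
    rw [Nat.coprime_comm, Nat.coprime_mul_left_add_right]; norm_num
  have h3 := hasValue_shiftedQuotient_add (c := 1) (j := 0) hζ hc h2 (v := 1)
    (by simpa [shiftedQuotient] using HasValue.one)
  have h4 : shiftedQuotient ζ 1 k = 0 := by
    refine prod_eq_zero (mem_range.mpr h1) ?_
    rw [show 3 * (2 * t + 1) + 1 = (3 * t + 2) * 2 by ring, pow_mul, hζ.pow_eq_one]
    simp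
  rw [h4, mul_zero, mul_zero, zero_add] at h3
  have h5 := (((hasValue_qInteger (hζ.ne_one (by omega)) (6 * k + 1)).locDvd_zero
    (by omega) hζ).mul hirr ((h3.locDvd_one (by omega) hζ).pow hirr 6)).mul hirr
    ((HasValue.X_pow ζ (3 * k)).locDvd_zero (by omega) hζ)
  simpa [seriesTerm] using h5

/-- Supplies the vanishing numerator factors needed for regularity of (q; q^3)_k and (q^2; q^3)_k
over (q^3; q^3)_k. -/
theorem exists_dvd_three_mul_add {d : ℕ} (hd : Nat.Coprime d 3) (hd1 : 1 < d) :
    (∃ l < d, d ∣ 3 * l + 1) ∧ ∃ i < d, d ∣ 3 * i + 2 := by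
  have h : d % 3 ≠ 0 := fun h => by
    have := Nat.dvd_gcd (Nat.dvd_of_mod_eq_zero h) (dvd_refl 3)
    rw [hd] at this
    omega
  rcases (by omega : d % 3 = 1 ∨ d % 3 = 2) with h | h
  · exact ⟨⟨d / 3, by omega, 1, by omega⟩, ⟨(2 * d - 2) / 3, by omega, 2, by omega⟩⟩
  · exact ⟨⟨(2 * d - 1) / 3, by omega, 2, by omega⟩, ⟨d / 3, by omega, 1, by omega⟩⟩

theorem locDvd_one_of_dvd {t M d : ℕ} (hM : M = 2 * t + 1 ∨ M = 3 * t + 1) (hd1 : 1 < d)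
    (hd : d ∣ 3 * t + 2) :
    LocDvd (Polynomial.cyclotomic d ℚ) 1
      (∑ k ∈ range (M + 1), seriesTerm RatFunc.X k - closedForm RatFunc.X t) := by
  have hζ := Complex.isPrimitiveRoot_exp d (by omega)
  generalize Complex.exp _ = ζ at hζ
  have hc : Nat.Coprime (3 * t + 2) 3 := by
    rw [Nat.coprime_comm, Nat.coprime_mul_left_add_right]; norm_num
  have hd3 : Nat.Coprime d 3 := hc.coprime_dvd_left hd
  obtain ⟨⟨l, hl, hl'⟩, i₀, hi₀, hi₀'⟩ := exists_dvd_three_mul_add hd3 hd1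
  have hsum : HasValue ζ (∑ k ∈ range (M + 1), seriesTerm RatFunc.X k) 0 := by
    rcases hM with rfl | rfl
    -- Both sides solve 3x + 1 ≡ 0 mod d, so the last, incomplete block stops at l, where its sum
    -- vanishes by antisymmetry.
    · have h1 : 2 * t + 1 ≡ l [MOD d] := by
        refine Nat.ModEq.cancel_left_of_coprime (c := 3) hd3 (Nat.ModEq.add_right_cancel' 1 ?_)
        refine ((Nat.modEq_zero_iff_dvd.mpr ?_).trans (Nat.modEq_zero_iff_dvd.mpr hl').symm)
        rw [show 3 * (2 * t + 1) + 1 = (3 * t + 2) * 2 by ring]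
        exact hd.mul_right 2
      have h2 : (2 * t + 1) % d = l := by rw [h1, Nat.mod_eq_of_lt hl]
      have h3 := Nat.div_add_mod (2 * t + 1) d
      rw [h2] at h3
      rw [← h3, add_assoc]
      exact hasValue_sum_seriesTerm hζ hd1 hd3 hl hl' _ (by omega)
        (sum_seriesTerm_eq_zero hζ hd1 hd3 hl ((hζ.pow_eq_one_iff_dvd _).mpr hl'))
    · obtain ⟨J, hJ⟩ := hd
      -- Here M + 1 = n is a multiple of d, so only complete blocks occur.
      rw [show 3 * t + 1 + 1 = d * J + 0 by omega]
      exact hasValue_sum_seriesTerm hζ hd1 hd3 hl hl' _ (by omega) (by simp)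
  obtain ⟨v, hv⟩ := exists_hasValue_shiftedQuotient_mul hζ hd3 hi₀ hi₀' ((2 * t + 1) / d)
  have hv' := hasValue_shiftedQuotient_add hζ hd3 (Nat.mod_lt (2 * t + 1) (by omega : 0 < d)) hv
  rw [Nat.div_add_mod] at hv'
  have hq : qInteger ζ (2 * (3 * t + 2)) = 0 := by
    rw [qInteger, (hζ.pow_eq_one_iff_dvd _).mpr (hd.mul_left 2), sub_self, zero_div]
  have h := hsum.add (((HasValue.of_polynomial ζ (-5)).mul
    (hasValue_qInteger (hζ.ne_one hd1) (2 * (3 * t + 2)))).mul (hv'.pow 3))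
  rw [hq, mul_zero, zero_mul, add_zero, map_neg, map_ofNat, neg_mul, neg_mul, ← sub_eq_add_neg] at h
  exact h.locDvd_one (by omega) hζ

theorem qIntegerPoly_mul_dvd_num {n : ℕ} (hn : 1 < n) {f : RatFunc ℚ}
    (h6 : LocDvd (Polynomial.cyclotomic n ℚ) 6 f)
    (h1 : ∀ d, d ∣ n → 1 < d → LocDvd (Polynomial.cyclotomic d ℚ) 1 f) :
    qIntegerPoly n * Polynomial.cyclotomic n ℚ ^ 5 ∣ f.num := by
  have hn' : n ∈ n.divisors.erase 1 := by simp; omega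
  have hmem {d : ℕ} (hd : d ∈ (n.divisors.erase 1).erase n) : d ≠ n ∧ 1 < d ∧ d ∣ n := by
    simp only [mem_erase, Nat.mem_divisors] at hd
    exact ⟨hd.1, by have := Nat.pos_of_dvd_of_pos hd.2.2.1 (by omega); omega, hd.2.2.1⟩
  -- The factor d = n of [n] is merged with Φ_n^5 into Φ_n^6, which is coprime to the rest.
  rw [qIntegerPoly, ← Polynomial.prod_cyclotomic_eq_geom_sum (by omega) ℚ,
    ← mul_prod_erase _ _ hn', mul_right_comm, ← pow_succ']
  refine IsCoprime.mul_dvd ?_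
    (h6.pow_dvd_num (Polynomial.cyclotomic.irreducible_rat (by omega))) ?_
  · exact (IsCoprime.prod_right fun d hd =>
      Polynomial.cyclotomic.isCoprime_rat (hmem hd).1.symm).pow_left
  · refine Finset.prod_dvd_of_coprime (fun a _ b _ hab => Polynomial.cyclotomic.isCoprime_rat hab)
      fun d hd => ?_
    have h := (h1 d (hmem hd).2.2 (hmem hd).2.1).pow_dvd_num
      (Polynomial.cyclotomic.irreducible_rat (by have := (hmem hd).2.1; omega))
    rwa [pow_one] at h

end Supercongruence

theorem theorem1p3 (n : ℕ) (hn : n ≡ 2 [MOD 3]) (M : ℕ)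
    (hM : M = (2 * n - 1) / 3 ∨ M = n - 1) (q : RatFunc ℚ) (hq : q = RatFunc.X) :
    QCongr (qIntegerPoly n * Polynomial.cyclotomic n ℚ ^ 5)
      (∑ k ∈ Finset.range (M + 1),
        qInteger q (6 * k + 1) * (qShifted q (q ^ 3) k ^ 6 / qShifted (q ^ 3) (q ^ 3) k ^ 6)
          * q ^ (3 * k))
      (5 * qInteger q (2 * n) *
        (qShifted (q ^ 2) (q ^ 3) ((2 * n - 1) / 3) ^ 3 /
          qShifted (q ^ 3) (q ^ 3) ((2 * n - 1) / 3) ^ 3)) := by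
  subst hq
  obtain ⟨t, rfl⟩ : ∃ t, n = 3 * t + 2 := ⟨n / 3, by have : n % 3 = 2 := hn; omega⟩
  rw [show (2 * (3 * t + 2) - 1) / 3 = 2 * t + 1 by omega] at hM ⊢
  rw [show 3 * t + 2 - 1 = 3 * t + 1 by omega] at hM
  have h1 (k : ℕ) : qShifted (RatFunc.X : RatFunc ℚ) (RatFunc.X ^ 3) k /
      qShifted (RatFunc.X ^ 3) (RatFunc.X ^ 3) k = shiftedQuotient RatFunc.X 1 k := by
    rw [← qShifted_div, pow_one]
  simp only [← div_pow, h1, qShifted_div]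
  refine qIntegerPoly_mul_dvd_num (by omega) ?_ fun d hd hd1 => locDvd_one_of_dvd hM hd1 hd
  have hζ := Complex.isPrimitiveRoot_exp (3 * t + 2) (by omega)
  have h6 := locDvd_six hζ
  rcases hM with rfl | rfl
  · exact h6
  · have hirr := Polynomial.cyclotomic.irreducible_rat (show 0 < 3 * t + 2 by omega)
    have h := h6.add hirr (LocDvd.sum hirr (Ico (2 * t + 1 + 1) (3 * t + 1 + 1)) fun k hk =>
      locDvd_six_seriesTerm hζ (mem_Ico.mp hk).1 (mem_Ico.mp hk).2)
    rw [sub_add_eq_add_sub,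
      sum_range_add_sum_Ico _ (show 2 * t + 1 + 1 ≤ 3 * t + 1 + 1 by omega)] at h
    exact h
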